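/- Let $G$ be a compact group with normalized Haar measure $dg$, and let $g\mapsto U_g$ and $g\mapsto V_g$ be two continuous finite-dimensional unitary (matrix) representations of $G$, on $\mathcal H_{\rm in}=\mathbb C^{d_{\rm in}}$ and $\mathcal H_{\rm out}=\mathbb C^{d_{\rm out}}$. For a unitary $W$ on $\mathbb C^d$ put $|\Phi_W\rangle=(W\otimes I)|\Phi\rangle$ with $|\Phi\rangle=d^{-1/2}\sum_{n=1}^d|n\rangle\otimes|n\rangle$. For an irreducible representation $l$ contained in $\{V_g\otimes\overline U_g\}$ let $d_l$ be its dimension and $m_l$ its multiplicity in $\{V_g\otimes\overline U_g\}$, where $\overline U_g$ is the entrywise complex conjugate of $U_g$. Suppose that the maximum of $m_l/d_l$ over these irreducible representations is attained by one with $m_l=1$. (1) If $\{U_g\}$ is irreducible, then the optimal Bell state conversion $|\Phi_{U_g}\rangle\to|\Phi_{V_g}\rangle$ can be achieved by local operations: there are quantum channels (completely positive trace-preserving maps) $\mathcal A,\mathcal B$ from operators on $\mathcal H_{\rm in}$ to operators on $\mathcal H_{\rm out}$ such that the average fidelity $$\int dg\,\langle\Phi_{V_g}|\,(\mathcal A\otimes\mathcal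 B)(|\Phi_{U_g}\rangle\langle\Phi_{U_g}|)\,|\Phi_{V_g}\rangle$$ equals both the maximum of $\int dg\,\langle\Phi_{V_g}|\mathcal C(|\Phi_{U_g}\rangle\langle\Phi_{U_g}|)|\Phi_{V_g}\rangle$ over all joint quantum channels $\mathcal C$ and the maximum of $$\frac{\int dg\,\langle\Phi_{V_g}|\mathcal M(|\Phi_{U_g}\rangle\langle\Phi_{U_g}|)|\Phi_{V_g}\rangle}{\int dg\,\mathrm{Tr}\,[\mathcal M(|\Phi_{U_g}\rangle\langle\Phi_{U_g}|)]}$$ over all joint quantum operations (completely positive trace-non-increasing maps) $\mathcal M$ with nonzero denominator. (2) If both $\{U_g\}$ and $\{V_g\}$ are irreducible, then the optimal simulation $U_g\to V_g$ with one use of $U_g$ can be achieved by a network without internal memory: there are quantum channels $\mathcal A$ from $\mathcal H_{\rm out}$ to $\mathcal H_{\rm in}$ and $\mathcal B$ from $\mathcal H_{\rm in}$ to $\mathcal H_{\rm out}$ such that, with $\mathcal U_g(\rho)=U_g\rho U_g^\dagger$ and $\mathcal Q_g=\mathcal B\circ\mathcal U_g\circ\mathcal A$, the average entanglement fidelity $$\int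 dg\,\langle\Phi_{V_g}|\,(\mathcal Q_g\otimes\mathcal I_{\rm out})(|\Phi_{\rm out}\rangle\langle\Phi_{\rm out}|)\,|\Phi_{V_g}\rangle ,$$ where $|\Phi_{\rm out}\rangle$ is the state $|\Phi\rangle$ on $\mathcal H_{\rm out}\otimes\mathcal H_{\rm out}$, equals the maximum of the same quantity over all networks $\mathcal Q_g=\mathcal B'\circ(\mathcal U_g\otimes\mathcal I_{\rm mem})\circ\mathcal A'$ in which $\mathcal A'$, $\mathcal B'$ are quantum channels and the internal memory has arbitrary finite dimension, and also equals the maximum of that quantity divided by the average success probability $\int dg\,\mathrm{Tr}[(\mathcal Q_g\otimes\mathcal I_{\rm out})(|\Phi_{\rm out}\rangle\langle\Phi_{\rm out}|)]$ over all such networks in which $\mathcal A'$, $\mathcal B'$ are quantum operations and this probability is nonzero. -/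

import Mathlib

open MeasureTheory Matrix
open scoped Kronecker ComplexOrder

noncomputable section

namespace BellConversion

/-! ### Linear maps on matrices: tensor products, channels, quantum operations -/

/-- The tensor product `Φ ⊗ Ψ` of two linear maps on matrices, i.e. the linear map that sends
`X ⊗ Y` to `Φ X ⊗ Ψ Y`; it is defined by expanding its argument in the matrix units
`E_{i i'} ⊗ E_{j j'}`. -/
def tensorMap {n₁ n₂ m₁ m₂ : Type*} [Fintype n₁] [DecidableEq n₁] [Fintype n₂] [DecidableEq n₂]
    (Φ : Matrix n₁ n₁ ℂ →ₗ[ℂ] Matrix m₁ m₁ ℂ) (Ψ : Matrix n₂ n₂ ℂ →ₗ[ℂ] Matrix m₂ m₂ ℂ) :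
    Matrix (n₁ × n₂) (n₁ × n₂) ℂ →ₗ[ℂ] Matrix (m₁ × m₂) (m₁ × m₂) ℂ where
  toFun X := ∑ i, ∑ i', ∑ j, ∑ j',
    X (i, j) (i', j') • (Φ (Matrix.single i i' 1) ⊗ₖ Ψ (Matrix.single j j' 1))
  map_add' X Y := by simp only [Matrix.add_apply, add_smul, Finset.sum_add_distrib]
  map_smul' c X := by
    simp only [Matrix.smul_apply, smul_assoc, Finset.smul_sum, RingHom.id_apply]

/-- A linear map on matrices is determined by its values on the matrix units. -/
theorem map_eq_sum_single {p q : Type*} [Fintype p] [DecidableEq p]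
    (F : Matrix p p ℂ →ₗ[ℂ] Matrix q q ℂ) (Z : Matrix p p ℂ) :
    F Z = ∑ i, ∑ i', Z i i' • F (Matrix.single i i' 1) := by
  conv_lhs => rw [matrix_eq_sum_single Z]
  simp only [map_sum]
  refine Finset.sum_congr rfl fun i _ => Finset.sum_congr rfl fun j _ => ?_
  rw [← map_smul, smul_single, smul_eq_mul, mul_one]

/-- The defining property of the tensor product of two maps. -/
theorem tensorMap_kronecker {n₁ n₂ m₁ m₂ : Type*} [Fintype n₁] [DecidableEq n₁] [Fintype n₂]
    [DecidableEq n₂]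
    (Φ : Matrix n₁ n₁ ℂ →ₗ[ℂ] Matrix m₁ m₁ ℂ) (Ψ : Matrix n₂ n₂ ℂ →ₗ[ℂ] Matrix m₂ m₂ ℂ)
    (X : Matrix n₁ n₁ ℂ) (Y : Matrix n₂ n₂ ℂ) :
    tensorMap Φ Ψ (X ⊗ₖ Y) = Φ X ⊗ₖ Ψ Y := by
  have hX : Φ X = _ := map_eq_sum_single Φ X
  have hY : Ψ Y = _ := map_eq_sum_single Ψ Y
  ext ⟨a, b⟩ ⟨a', b'⟩
  rw [kroneckerMap_apply, hX, hY]
  simp only [tensorMap, LinearMap.coe_mk, AddHom.coe_mk, kroneckerMap_apply, Matrix.sum_apply,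
    Matrix.smul_apply, smul_eq_mul]
  simp only [Finset.sum_mul]
  simp only [Finset.mul_sum]
  refine Finset.sum_congr rfl fun i _ => Finset.sum_congr rfl fun i' _ =>
    Finset.sum_congr rfl fun j _ => Finset.sum_congr rfl fun j' _ => ?_
  ring

/-- Complete positivity: `Φ ⊗ id_k` preserves positive semidefiniteness for every `k`. -/
def IsCompletelyPositive {n m : Type*} [Fintype n] [DecidableEq n] [Fintype m]
    (Φ : Matrix n n ℂ →ₗ[ℂ] Matrix m m ℂ) : Prop :=
  ∀ (k : ℕ) (X : Matrix (n × Fin k) (n × Fin k) ℂ), X.PosSemidef →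
    (tensorMap Φ (LinearMap.id : Matrix (Fin k) (Fin k) ℂ →ₗ[ℂ] Matrix (Fin k) (Fin k) ℂ)
      X).PosSemidef

/-- A quantum channel (deterministic operation): completely positive and trace preserving. -/
structure IsChannel {n m : Type*} [Fintype n] [DecidableEq n] [Fintype m]
    (Φ : Matrix n n ℂ →ₗ[ℂ] Matrix m m ℂ) : Prop where
  completelyPositive : IsCompletelyPositive Φ
  trace_eq : ∀ X : Matrix n n ℂ, (Φ X).trace = X.trace

/-- A quantum operation (probabilistic operation): completely positive and trace
non-increasing. -/
structure IsQuantumOperation {n m : Type*} [Fintype n] [DecidableEq n] [Fintype m]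
    (Φ : Matrix n n ℂ →ₗ[ℂ] Matrix m m ℂ) : Prop where
  completelyPositive : IsCompletelyPositive Φ
  trace_le : ∀ X : Matrix n n ℂ, X.PosSemidef → (Φ X).trace.re ≤ X.trace.re

/-- The unitary channel `X ↦ W X W†`. -/
def unitaryChannel {n : Type*} [Fintype n] [DecidableEq n] (W : Matrix.unitaryGroup n ℂ) :
    Matrix n n ℂ →ₗ[ℂ] Matrix n n ℂ where
  toFun X := W.val * X * W.valᴴ
  map_add' X Y := by rw [Matrix.mul_add, Matrix.add_mul]
  map_smul' c X := by rw [Matrix.mul_smul, Matrix.smul_mul, RingHom.id_apply]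

/-! ### Bell states -/

/-- The canonical Bell state `|Φ⟩ = d^{-1/2} ∑ₙ |n⟩ ⊗ |n⟩`. -/
def bell (n : Type*) [Fintype n] [DecidableEq n] : n × n → ℂ :=
  fun p => if p.1 = p.2 then ((Real.sqrt (Fintype.card n) : ℝ) : ℂ)⁻¹ else 0

/-- The Bell state `|Φ_W⟩ = (W ⊗ I) |Φ⟩`. -/
def bellOf {n : Type*} [Fintype n] [DecidableEq n] (W : Matrix.unitaryGroup n ℂ) : n × n → ℂ :=
  (W.val ⊗ₖ (1 : Matrix n n ℂ)) *ᵥ bell n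

/-- The rank-one operator `|ψ⟩⟨ψ|`. -/
def pureState {a : Type*} (ψ : a → ℂ) : Matrix a a ℂ := vecMulVec ψ (star ψ)

/-- The fidelity `⟨ψ| ρ |ψ⟩`. -/
def overlap {a : Type*} [Fintype a] (ψ : a → ℂ) (ρ : Matrix a a ℂ) : ℝ :=
  (star ψ ⬝ᵥ (ρ *ᵥ ψ)).re

/-! ### Representations -/

/-- A unitary matrix representation, as a representation on the space of column vectors. -/
def unitaryRep {G : Type*} [Group G] {n : Type*} [Fintype n] [DecidableEq n]
    (U : G →* Matrix.unitaryGroup n ℂ) : Representation ℂ G (n → ℂ) where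
  toFun g := Matrix.toLin' (U g).val
  map_one' := by simp [Module.End.one_eq_id]
  map_mul' g h := by simp [Matrix.toLin'_mul, Module.End.mul_eq_comp]

/-- The representation `g ↦ V_g ⊗ Ū_g`, with `Ū_g` the entrywise complex conjugate of `U_g`. -/
def tensorConjRep {G : Type*} [Group G] {n m : Type*} [Fintype n] [DecidableEq n] [Fintype m]
    [DecidableEq m] (U : G →* Matrix.unitaryGroup n ℂ) (V : G →* Matrix.unitaryGroup m ℂ) :
    Representation ℂ G (m × n → ℂ) where
  toFun g := Matrix.toLin' ((V g).val ⊗ₖ (U g).val.map (starRingEnd ℂ))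
  map_one' := by
    simp [Module.End.one_eq_id, Matrix.map_one]
  map_mul' g h := by
    rw [map_mul, map_mul, Submonoid.coe_mul, Submonoid.coe_mul, Matrix.map_mul,
      Matrix.mul_kronecker_mul, Matrix.toLin'_mul, Module.End.mul_eq_comp]

/-- The multiplicity of the irreducible representation `σ` in the finite-dimensional completely
reducible complex representation `ρ`: the dimension of the space of intertwining maps from `σ`
to `ρ`. -/
def multiplicity {G : Type*} [Group G] {E F : Type*} [AddCommGroup E] [Module ℂ E]
    [AddCommGroup F] [Module ℂ F] (σ : Representation ℂ G E) (ρ : Representation ℂ G F) : ℕ :=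
  Module.finrank ℂ (Representation.IntertwiningMap σ ρ)

/-- The ratio `m_l / d_l` for the irreducible representation `l` realised on the invariant
subspace `W` of the space of `ρ`. -/
def multRatio {G : Type*} [Group G] {F : Type*} [AddCommGroup F] [Module ℂ F]
    {ρ : Representation ℂ G F} (W : Subrepresentation ρ) : ℝ :=
  (multiplicity W.toRepresentation ρ : ℝ) / (Module.finrank ℂ W.toSubmodule : ℝ)

/-! ### Conversion of Bell states -/

section Bell

variable {G : Type*} [Group G] [MeasurableSpace G] (μ : Measure G)
  {n m : Type*} [Fintype n] [DecidableEq n] [Fintype m] [DecidableEq m]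
  (U : G →* Matrix.unitaryGroup n ℂ) (V : G →* Matrix.unitaryGroup m ℂ)

/-- `∫ dg ⟨Φ_{V_g}| M(|Φ_{U_g}⟩⟨Φ_{U_g}|) |Φ_{V_g}⟩`, the average fidelity when `M` is a
channel. -/
def bellFidelity (M : Matrix (n × n) (n × n) ℂ →ₗ[ℂ] Matrix (m × m) (m × m) ℂ) : ℝ :=
  ∫ g, overlap (bellOf (V g)) (M (pureState (bellOf (U g)))) ∂μ

/-- The success probability `∫ dg Tr[M(|Φ_{U_g}⟩⟨Φ_{U_g}|)]`. -/
def bellSuccess (M : Matrix (n × n) (n × n) ℂ →ₗ[ℂ] Matrix (m × m) (m × m) ℂ) : ℝ :=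
  ∫ g, (M (pureState (bellOf (U g)))).trace.re ∂μ

/-- The fidelities of `|Φ_{U_g}⟩ → |Φ_{V_g}⟩` achieved by (arbitrary, joint) channels. -/
def detBellFidelities : Set ℝ :=
  {f | ∃ C : Matrix (n × n) (n × n) ℂ →ₗ[ℂ] Matrix (m × m) (m × m) ℂ,
    IsChannel C ∧ f = bellFidelity μ U V C}

/-- The fidelities of `|Φ_{U_g}⟩ → |Φ_{V_g}⟩` achieved, conditionally on success, by (arbitrary,
joint) quantum operations. -/
def probBellFidelities : Set ℝ :=
  {f | ∃ M : Matrix (n × n) (n × n) ℂ →ₗ[ℂ] Matrix (m × m) (m × m) ℂ,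
    IsQuantumOperation M ∧ 0 < bellSuccess μ U M ∧ f = bellFidelity μ U V M / bellSuccess μ U M}

/-- `C` is an optimal conversion `|Φ_{U_g}⟩ → |Φ_{V_g}⟩`: its fidelity is the largest one among
deterministic machines, and also the largest one among probabilistic machines. -/
def IsOptimalBellConversion
    (C : Matrix (n × n) (n × n) ℂ →ₗ[ℂ] Matrix (m × m) (m × m) ℂ) : Prop :=
  IsGreatest (detBellFidelities μ U V) (bellFidelity μ U V C) ∧
    IsGreatest (probBellFidelities μ U V) (bellFidelity μ U V C)

end Bell

/-! ### Simulation of gates -/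

/-- The map implemented by a network with one open slot: the operation `A` acts on the input and
prepares the input of the slot and a `k`-dimensional internal memory, the gate `W` is inserted in
the slot, and finally `B` acts on the output of the slot and on the memory. -/
def network {n m : Type*} [Fintype n] [DecidableEq n] [Fintype m] [DecidableEq m] {k : ℕ}
    (A : Matrix m m ℂ →ₗ[ℂ] Matrix (n × Fin k) (n × Fin k) ℂ)
    (B : Matrix (n × Fin k) (n × Fin k) ℂ →ₗ[ℂ] Matrix m m ℂ)
    (W : Matrix.unitaryGroup n ℂ) : Matrix m m ℂ →ₗ[ℂ] Matrix m m ℂ :=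
  B ∘ₗ tensorMap (unitaryChannel W) LinearMap.id ∘ₗ A

/-- The map implemented by a network with one open slot and no internal memory. -/
def memorylessNetwork {n m : Type*} [Fintype n] [DecidableEq n] [Fintype m] [DecidableEq m]
    (A : Matrix m m ℂ →ₗ[ℂ] Matrix n n ℂ) (B : Matrix n n ℂ →ₗ[ℂ] Matrix m m ℂ)
    (W : Matrix.unitaryGroup n ℂ) : Matrix m m ℂ →ₗ[ℂ] Matrix m m ℂ :=
  B ∘ₗ unitaryChannel W ∘ₗ A

section Gate

variable {G : Type*} [Group G] [MeasurableSpace G] (μ : Measure G)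
  {n m : Type*} [Fintype n] [DecidableEq n] [Fintype m] [DecidableEq m]
  (U : G →* Matrix.unitaryGroup n ℂ) (V : G →* Matrix.unitaryGroup m ℂ)

/-- `∫ dg ⟨Φ_{V_g}| (Q_g ⊗ id)(|Φ_out⟩⟨Φ_out|) |Φ_{V_g}⟩`, the average entanglement fidelity when
all `Q_g` are channels. -/
def gateFidelity (Q : G → (Matrix m m ℂ →ₗ[ℂ] Matrix m m ℂ)) : ℝ :=
  ∫ g, overlap (bellOf (V g)) (tensorMap (Q g) LinearMap.id (pureState (bell m))) ∂μ

/-- The success probability `∫ dg Tr[(Q_g ⊗ id)(|Φ_out⟩⟨Φ_out|)]`. -/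
def gateSuccess (Q : G → (Matrix m m ℂ →ₗ[ℂ] Matrix m m ℂ)) : ℝ :=
  ∫ g, (tensorMap (Q g)
    (LinearMap.id : Matrix m m ℂ →ₗ[ℂ] Matrix m m ℂ) (pureState (bell m))).trace.re ∂μ

/-- The fidelities of `U_g → V_g` achieved by deterministic networks that use the gate once, with
an internal memory of arbitrary finite dimension. -/
def detGateFidelities : Set ℝ :=
  {f | ∃ (k : ℕ) (A : Matrix m m ℂ →ₗ[ℂ] Matrix (n × Fin k) (n × Fin k) ℂ)
    (B : Matrix (n × Fin k) (n × Fin k) ℂ →ₗ[ℂ] Matrix m m ℂ),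
    IsChannel A ∧ IsChannel B ∧ f = gateFidelity μ V (fun g => network A B (U g))}

/-- The fidelities of `U_g → V_g` achieved, conditionally on success, by probabilistic networks
that use the gate once, with an internal memory of arbitrary finite dimension. -/
def probGateFidelities : Set ℝ :=
  {f | ∃ (k : ℕ) (A : Matrix m m ℂ →ₗ[ℂ] Matrix (n × Fin k) (n × Fin k) ℂ)
    (B : Matrix (n × Fin k) (n × Fin k) ℂ →ₗ[ℂ] Matrix m m ℂ),
    IsQuantumOperation A ∧ IsQuantumOperation B ∧
    0 < gateSuccess μ (fun g => network A B (U g)) ∧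
    f = gateFidelity μ V (fun g => network A B (U g)) /
      gateSuccess μ (fun g => network A B (U g))}

/-- A network turning the gate `U_g` into the map `Q g` is an optimal simulation `U_g → V_g`: its
fidelity is the largest one among deterministic networks, and also the largest one among
probabilistic networks. -/
def IsOptimalGateSimulation (Q : G → (Matrix m m ℂ →ₗ[ℂ] Matrix m m ℂ)) : Prop :=
  IsGreatest (detGateFidelities μ U V) (gateFidelity μ V Q) ∧
    IsGreatest (probGateFidelities μ U V) (gateFidelity μ V Q)

end Gate

end BellConversion

end

namespace BellConversion

noncomputable section

set_option linter.unusedSectionVars false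

/-! ### Invariant projectors of a unitary representation -/

section Projectors

variable {G : Type*} [Group G] {N : Type*} [Fintype N] [DecidableEq N]
  {T : G →* Matrix.unitaryGroup N ℂ}

/-! Put T_g = V_g ⊗ Ū_g. For a Kraus operator K of a joint operation, the amplitude ⟨V_g|K|U_g⟩ is
the conjugate of Tr(X† T_g), where X is K with its indices rearranged
(`vectorize_dotProduct_mulVec`). So the average fidelity is a sum of mean squares of matrix
coefficients of T. Splitting T orthogonally into irreducible blocks P_i of dimension d_i, Schur
orthogonality gives the component Tr(X† P_i T_g) the mean square Tr(X† P_i X P_i)/d_i and kills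
cross terms between inequivalent blocks. At most m_i blocks interfere with block i, so the total is
at most max(m_l/d_l) · Tr(X† X) (`integral_normSq_trace_le`).

If U is irreducible, the average success probability is proportional to the same Tr(X† X)
(`integral_krausSuccess`), so fidelity divided by success is at most r·d_in/d_out with r = max
m_l/d_l. A network with memory depends linearly on the gate (`vectorize_network`) and obeys the same
bound.

When r is attained with m_l = 1, r = 1/d for an irreducible block of dimension d with projector P.
Let one Kraus family consist of the columns of P, the other of its rows. Their products give the
amplitudes (P T_g† P)_{w₂ w₁} up to scale. Since P commutes with the unitary T_g, their squares sum
to Tr P = d for every g, which meets the bound exactly (`krausFidelity_projectorKraus`). The two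
families are separately trace preserving because the partial traces of P are scalar: by
irreducibility of U for one, and of V for the other, which is needed when the row family is reversed
to act before the gate (`traceLeft_projector`, `traceRight_projector`). -/

theorem unitaryRep_apply (T : G →* Matrix.unitaryGroup N ℂ) (g : G) (v : N → ℂ) :
    unitaryRep T g v = (T g).val *ᵥ v := rfl

/-- `P` is the orthogonal projector onto the subspace `W`. -/
structure IsProjectorOnto (W : Submodule ℂ (N → ℂ)) (P : Matrix N N ℂ) : Prop where
  mul_self : P * P = P
  conjTranspose_eq : Pᴴ = P
  mem : ∀ v, P *ᵥ v ∈ W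
  mulVec_eq : ∀ v ∈ W, P *ᵥ v = v

/-- The space `N → ℂ` has no inner product structure, so the orthogonal projection is taken in
`EuclideanSpace` and carried back. -/
theorem exists_isProjectorOnto (W : Submodule ℂ (N → ℂ)) :
    ∃ P : Matrix N N ℂ, IsProjectorOnto W P := by
  let e : EuclideanSpace ℂ N ≃ₗ[ℂ] (N → ℂ) := WithLp.linearEquiv 2 ℂ (N → ℂ)
  let W' : Submodule ℂ (EuclideanSpace ℂ N) := W.comap e.toLinearMap
  let P : Matrix N N ℂ := Matrix.toEuclideanLin.symm W'.starProjection.toLinearMap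
  have hPl : Matrix.toEuclideanLin P = W'.starProjection.toLinearMap :=
    LinearEquiv.apply_symm_apply _ _
  have hP : ∀ v, P *ᵥ v = e (W'.starProjection (e.symm v)) := by
    intro v
    have : Matrix.toEuclideanLin P (e.symm v) = W'.starProjection (e.symm v) := by
      rw [hPl]; rfl
    rw [← this]
    rfl
  refine ⟨P, ?_, ?_, ?_, ?_⟩
  · apply Matrix.toLin'.injective
    ext1 v
    ext1
    simp only [LinearMap.comp_apply, Matrix.toLin'_apply, Matrix.toLin'_mul]
    rw [hP, hP]
    simp only [LinearEquiv.symm_apply_apply]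
    rw [Submodule.starProjection_eq_self_iff.mpr (Submodule.starProjection_apply_mem _ _)]
  · have h := Submodule.starProjection_isSymmetric (K := W')
    have h2 : (Matrix.toEuclideanLin P).IsSymmetric := by rw [hPl]; exact h
    exact (Matrix.isSymmetric_toEuclideanLin_iff.mp h2)
  · intro v
    rw [hP]
    exact Submodule.starProjection_apply_mem W' _
  · intro v hv
    rw [hP, Submodule.starProjection_eq_self_iff.mpr]
    · simp
    · change e (e.symm v) ∈ W
      simpa using hv

theorem IsProjectorOnto.trace_eq {W : Submodule ℂ (N → ℂ)} {P : Matrix N N ℂ}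
    (h : IsProjectorOnto W P) : P.trace = Module.finrank ℂ W := by
  have : LinearMap.IsProj W (Matrix.toLin' P) := ⟨h.mem, h.mulVec_eq⟩
  rw [← this.trace, Matrix.trace_toLin'_eq]

theorem IsProjectorOnto.mul_eq {W : Submodule ℂ (N → ℂ)} {P : Matrix N N ℂ}
    (h : IsProjectorOnto W P) {Z : Matrix N N ℂ} (hZ : ∀ v, Z *ᵥ v ∈ W) : P * Z = Z := by
  apply Matrix.toLin'.injective
  ext1 v
  ext1
  simp only [LinearMap.comp_apply, Matrix.toLin'_apply, Matrix.toLin'_mul]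
  exact h.mulVec_eq _ (hZ _)

theorem unitary_inv_val (T : G →* Matrix.unitaryGroup N ℂ) (g : G) :
    (T g⁻¹).val = (T g).valᴴ := by
  rw [map_inv]; rfl

theorem unitary_conjTranspose_mul (W : Matrix.unitaryGroup N ℂ) : W.valᴴ * W.val = 1 :=
  Matrix.UnitaryGroup.star_mul_self W

theorem unitary_mul_conjTranspose (W : Matrix.unitaryGroup N ℂ) : W.val * W.valᴴ = 1 :=
  Matrix.mem_unitaryGroup_iff.mp W.2

theorem commute_conjTranspose {A : Matrix N N ℂ} (hA : ∀ g, (T g).val * A = A * (T g).val)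
    (g : G) : (T g).valᴴ * A = A * (T g).valᴴ := by
  rw [← unitary_inv_val]; exact hA _

/-- The projector onto an invariant subspace commutes with the representation. -/
theorem IsProjectorOnto.commute {W : Subrepresentation (unitaryRep T)} {P : Matrix N N ℂ}
    (h : IsProjectorOnto W.toSubmodule P) (g : G) : (T g).val * P = P * (T g).val := by
  have key : ∀ g, P * ((T g).val * P) = (T g).val * P := fun g => h.mul_eq fun v => by
    rw [← Matrix.mulVec_mulVec]
    exact W.apply_mem_toSubmodule g (h.mem v)
  -- The adjoint of P T_{g⁻¹} P = T_{g⁻¹} P reads P T_g P = P T_g; with `key g` this gives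
  -- commutation.
  have h2 := congrArg conjTranspose (key g⁻¹)
  rw [unitary_inv_val] at h2
  simp only [conjTranspose_mul, conjTranspose_conjTranspose, h.conjTranspose_eq] at h2
  rw [← key g, ← Matrix.mul_assoc, h2]

/-- The range of a matrix that commutes with a representation, as a subrepresentation. -/
def rangeSubrep (P : Matrix N N ℂ) (hP : ∀ g, (T g).val * P = P * (T g).val) :
    Subrepresentation (unitaryRep T) where
  toSubmodule := LinearMap.range (Matrix.toLin' P)
  apply_mem_toSubmodule g v hv := by
    obtain ⟨w, rfl⟩ := hv
    refine ⟨(T g).val *ᵥ w, ?_⟩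
    simp only [Matrix.toLin'_apply, unitaryRep_apply, Matrix.mulVec_mulVec, hP]

theorem isProjectorOnto_range {P : Matrix N N ℂ} (h1 : P * P = P) (h2 : Pᴴ = P) :
    IsProjectorOnto (LinearMap.range (Matrix.toLin' P)) P where
  mul_self := h1
  conjTranspose_eq := h2
  mem v := ⟨v, rfl⟩
  mulVec_eq v hv := by
    obtain ⟨w, rfl⟩ := hv
    simp [Matrix.mulVec_mulVec, h1]

/-- A minimal nonzero subrepresentation is irreducible. -/
theorem isIrreducible_of_minimal {E : Type*} [AddCommGroup E] [Module ℂ E]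
    {ρ : Representation ℂ G E} (W : Subrepresentation ρ) (h0 : W.toSubmodule ≠ ⊥)
    (hmin : ∀ S : Subrepresentation ρ, S.toSubmodule ≤ W.toSubmodule → S.toSubmodule ≠ ⊥ →
      S.toSubmodule = W.toSubmodule) : W.toRepresentation.IsIrreducible := by
  have hne : (⊥ : Subrepresentation W.toRepresentation) ≠ ⊤ := by
    intro h
    have h' : (⊥ : Submodule ℂ W.toSubmodule) = ⊤ :=
      congrArg Subrepresentation.toSubmodule h
    apply h0
    rw [eq_bot_iff]
    intro v hv
    have : (⟨v, hv⟩ : W.toSubmodule) ∈ (⊥ : Submodule ℂ W.toSubmodule) := by rw [h']; trivial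
    simpa using this
  refine { toNontrivial := ⟨⊥, ⊤, hne⟩, eq_bot_or_eq_top := fun S => ?_ }
  let S' : Subrepresentation ρ :=
    { toSubmodule := S.toSubmodule.map W.toSubmodule.subtype
      apply_mem_toSubmodule := by
        rintro g _ ⟨w, hw, rfl⟩
        exact ⟨W.toRepresentation g w, S.apply_mem_toSubmodule g hw, rfl⟩ }
  by_cases hS : S'.toSubmodule = ⊥
  · left
    apply Subrepresentation.toSubmodule_injective
    change S.toSubmodule = ⊥
    apply Submodule.map_injective_of_injective W.toSubmodule.injective_subtype
    rw [Submodule.map_bot]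
    exact hS
  · right
    have h := hmin S' (Submodule.map_subtype_le _ _) hS
    apply Subrepresentation.toSubmodule_injective
    change S.toSubmodule = ⊤
    apply Submodule.map_injective_of_injective W.toSubmodule.injective_subtype
    rw [Submodule.map_top, Submodule.range_subtype]
    exact h

/-- A nonzero subrepresentation of least dimension inside `S` is minimal. -/
theorem exists_irreducible_le {E : Type*} [AddCommGroup E] [Module ℂ E] [FiniteDimensional ℂ E]
    {ρ : Representation ℂ G E} (S : Subrepresentation ρ) (hS : S.toSubmodule ≠ ⊥) :
    ∃ W : Subrepresentation ρ, W.toSubmodule ≤ S.toSubmodule ∧ W.toSubmodule ≠ ⊥ ∧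
      W.toRepresentation.IsIrreducible := by
  let p : ℕ → Prop := fun d => ∃ W : Subrepresentation ρ, W.toSubmodule ≤ S.toSubmodule ∧
    W.toSubmodule ≠ ⊥ ∧ Module.finrank ℂ W.toSubmodule = d
  have hp : ∃ d, p d := ⟨_, S, le_rfl, hS, rfl⟩
  classical
  obtain ⟨W, h1, h2, h3⟩ := Nat.find_spec hp
  refine ⟨W, h1, h2, isIrreducible_of_minimal W h2 fun S' hS' hne => ?_⟩
  refine Submodule.eq_of_le_of_finrank_le hS' ?_
  rw [h3]
  exact Nat.find_min' hp ⟨S', hS'.trans h1, hne, rfl⟩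

theorem finrank_pos_of_isIrreducible {E : Type*} [AddCommGroup E] [Module ℂ E]
    [FiniteDimensional ℂ E] {ρ : Representation ℂ G E} {W : Subrepresentation ρ}
    (hW : W.toRepresentation.IsIrreducible) : 0 < Module.finrank ℂ W.toSubmodule := by
  obtain ⟨S, S', hne⟩ := hW.toNontrivial
  by_contra h0
  have : Subsingleton W.toSubmodule := Module.finrank_zero_iff.mp (Nat.eq_zero_of_not_pos h0)
  exact hne (Subrepresentation.toSubmodule_injective (Subsingleton.elim _ _))

/-- An orthogonal decomposition of `Q` into projectors onto irreducible invariant subspaces. -/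
theorem exists_decomposition_of_projector (T : G →* Matrix.unitaryGroup N ℂ) (d : ℕ) :
    ∀ Q : Matrix N N ℂ, Q * Q = Q → Qᴴ = Q → (∀ g, (T g).val * Q = Q * (T g).val) →
    Module.finrank ℂ (LinearMap.range (Matrix.toLin' Q)) ≤ d →
    ∃ (ι : Type) (_ : Fintype ι) (W : ι → Subrepresentation (unitaryRep T))
      (P : ι → Matrix N N ℂ), (∀ i, (W i).toRepresentation.IsIrreducible) ∧
      (∀ i, IsProjectorOnto (W i).toSubmodule (P i)) ∧
      (∀ i j, i ≠ j → P i * P j = 0) ∧ (∀ i, P i * Q = P i) ∧ (∀ i, Q * P i = P i) ∧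
      ∑ i, P i = Q := by
  induction d with
  | zero =>
    intro Q _ _ _ hd
    have : Q = 0 := by
      have h := Submodule.finrank_eq_zero.mp (Nat.le_zero.mp hd)
      rw [LinearMap.range_eq_bot] at h
      simpa using h
    subst this
    exact ⟨Empty, inferInstance, fun i => i.elim, fun i => i.elim, fun i => i.elim,
      fun i => i.elim, fun i => i.elim, fun i => i.elim, fun i => i.elim, by simp⟩
  | succ d ih =>
    intro Q hQ hQ' hQT hd
    by_cases h0 : LinearMap.range (Matrix.toLin' Q) = ⊥
    · refine ih Q hQ hQ' hQT ?_
      rw [h0]; simp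
    -- Split off one irreducible block: Q - P₀ is again an invariant orthogonal projector, of
    -- strictly smaller rank, and the induction applies to it.
    obtain ⟨W₀, hle, hne, hirr⟩ := exists_irreducible_le (rangeSubrep Q hQT) h0
    obtain ⟨P₀, hP₀⟩ := exists_isProjectorOnto W₀.toSubmodule
    have hQP : Q * P₀ = P₀ := (isProjectorOnto_range hQ hQ').mul_eq fun v => hle (hP₀.mem v)
    have hPQ : P₀ * Q = P₀ := by
      have := congrArg conjTranspose hQP
      rwa [conjTranspose_mul, hP₀.conjTranspose_eq, hQ'] at this
    have hQ1 : (Q - P₀) * (Q - P₀) = Q - P₀ := by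
      simp [Matrix.sub_mul, Matrix.mul_sub, hQ, hQP, hPQ, hP₀.mul_self]
    have hQ2 : (Q - P₀)ᴴ = Q - P₀ := by rw [conjTranspose_sub, hQ', hP₀.conjTranspose_eq]
    have hQ3 : ∀ g, (T g).val * (Q - P₀) = (Q - P₀) * (T g).val := fun g => by
      rw [Matrix.mul_sub, Matrix.sub_mul, hQT, hP₀.commute]
    have hlt : LinearMap.range (Matrix.toLin' (Q - P₀)) < LinearMap.range (Matrix.toLin' Q) := by
      refine lt_of_le_of_ne ?_ ?_
      · rintro _ ⟨v, rfl⟩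
        refine ⟨(Q - P₀) *ᵥ v, ?_⟩
        simp only [Matrix.toLin'_apply, Matrix.mulVec_mulVec, Matrix.mul_sub, hQ, hQP]
      · intro heq
        obtain ⟨v, hv, hv0⟩ := Submodule.exists_mem_ne_zero_of_ne_bot hne
        have h1 : v ∈ LinearMap.range (Matrix.toLin' (Q - P₀)) := by
          rw [heq]; exact hle hv
        have h2 := (isProjectorOnto_range hQ1 hQ2).mulVec_eq v h1
        have h3 := (isProjectorOnto_range hQ hQ').mulVec_eq v (hle hv)
        rw [Matrix.sub_mulVec, h3, hP₀.mulVec_eq v hv, sub_self] at h2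
        exact hv0 h2.symm
    have hlt' := Submodule.finrank_lt_finrank_of_lt hlt
    obtain ⟨ι, _, W, P, h1, h2, h3, h4, h5, h6⟩ := ih (Q - P₀) hQ1 hQ2 hQ3 (by omega)
    have hz1 : ∀ i, P i * P₀ = 0 := fun i => by
      rw [← h4 i, Matrix.mul_assoc, Matrix.sub_mul, hQP, hP₀.mul_self, sub_self, Matrix.mul_zero]
    have hz2 : ∀ i, P₀ * P i = 0 := fun i => by
      rw [← h5 i, ← Matrix.mul_assoc, Matrix.mul_sub, hPQ, hP₀.mul_self, sub_self,
        Matrix.zero_mul]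
    refine ⟨Option ι, inferInstance, fun o => o.elim W₀ W, fun o => o.elim P₀ P, ?_, ?_, ?_, ?_,
      ?_, ?_⟩
    · rintro (_ | i)
      exacts [hirr, h1 i]
    · rintro (_ | i)
      exacts [hP₀, h2 i]
    · rintro (_ | i) (_ | j) hij
      · exact absurd rfl hij
      · exact hz2 j
      · exact hz1 i
      · exact h3 i j fun h => hij (by rw [h])
    · rintro (_ | i)
      · exact hPQ
      · have := h4 i
        rw [Matrix.mul_sub, hz1, sub_zero] at this
        exact this
    · rintro (_ | i)
      · exact hQP
      · have := h5 i
        rw [Matrix.sub_mul, hz2, sub_zero] at this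
        exact this
    · rw [Fintype.sum_option]
      simp [h6]

/-- A unitary representation is an orthogonal sum of irreducible ones. -/
theorem exists_irreducible_decomposition (T : G →* Matrix.unitaryGroup N ℂ) :
    ∃ (ι : Type) (_ : Fintype ι) (W : ι → Subrepresentation (unitaryRep T))
      (P : ι → Matrix N N ℂ), (∀ i, (W i).toRepresentation.IsIrreducible) ∧
      (∀ i, IsProjectorOnto (W i).toSubmodule (P i)) ∧
      (∀ i j, i ≠ j → P i * P j = 0) ∧ ∑ i, P i = 1 := by
  obtain ⟨ι, hι, W, P, h1, h2, h3, -, -, h6⟩ := exists_decomposition_of_projector T _ 1 (by simp)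
    (by simp) (by simp) le_rfl
  exact ⟨ι, hι, W, P, h1, h2, h3, h6⟩

/-! ### Schur's lemma for matrices -/

/-- A matrix that commutes with the representation, as an intertwining map on a
subrepresentation. -/
def intertwiningOfCommute (Z : Matrix N N ℂ) (hZ : ∀ g, (T g).val * Z = Z * (T g).val)
    (W : Subrepresentation (unitaryRep T)) :
    Representation.IntertwiningMap W.toRepresentation (unitaryRep T) where
  toLinearMap := (Matrix.toLin' Z) ∘ₗ W.toSubmodule.subtype
  isIntertwining' g := by
    ext1 v
    change Z *ᵥ ((T g).val *ᵥ v.1) = (T g).val *ᵥ (Z *ᵥ v.1)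
    rw [Matrix.mulVec_mulVec, Matrix.mulVec_mulVec, hZ]

/-- Schur's lemma on an irreducible invariant subspace. -/
theorem schur_on_subspace {W : Subrepresentation (unitaryRep T)}
    (hW : W.toRepresentation.IsIrreducible) {P Z : Matrix N N ℂ}
    (hP : IsProjectorOnto W.toSubmodule P) (hZ : ∀ g, (T g).val * Z = Z * (T g).val)
    (hPZ : P * Z = Z) (hZP : Z * P = Z) : ∃ c : ℂ, Z = c • P := by
  have hmem : ∀ v, Z *ᵥ v ∈ W.toSubmodule := fun v => by
    rw [← hPZ, ← Matrix.mulVec_mulVec]; exact hP.mem _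
  let f : Representation.IntertwiningMap W.toRepresentation W.toRepresentation :=
    { toLinearMap := (Matrix.toLin' Z).restrict fun v _ => hmem v
      isIntertwining' := fun g => by
        ext1 v
        apply Subtype.ext
        change Z *ᵥ ((T g).val *ᵥ v.1) = (T g).val *ᵥ (Z *ᵥ v.1)
        rw [Matrix.mulVec_mulVec, Matrix.mulVec_mulVec, hZ] }
  obtain ⟨c, hc⟩ :=
    (Representation.IsIrreducible.algebraMap_intertwiningMap_bijective_of_isAlgClosed).2 f
  refine ⟨c, ?_⟩
  have hv : ∀ v : W.toSubmodule, Z *ᵥ v.1 = c • v.1 := by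
    intro v
    have h1 : f v = (algebraMap ℂ _ c : Representation.IntertwiningMap W.toRepresentation
      W.toRepresentation) v := by rw [hc]
    have h2 := congrArg Subtype.val h1
    exact h2
  apply Matrix.toLin'.injective
  ext1 v
  ext1
  simp only [LinearMap.comp_apply, Matrix.toLin'_apply]
  rw [← hZP, ← Matrix.mulVec_mulVec, hv ⟨_, hP.mem _⟩, Matrix.smul_mulVec]

/-- Schur's lemma for an irreducible matrix representation. -/
theorem schur_unitaryRep (hT : (unitaryRep T).IsIrreducible) {Z : Matrix N N ℂ}
    (hZ : ∀ g, (T g).val * Z = Z * (T g).val) : ∃ c : ℂ, Z = c • (1 : Matrix N N ℂ) := by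
  let f : Representation.IntertwiningMap (unitaryRep T) (unitaryRep T) :=
    { toLinearMap := Matrix.toLin' Z
      isIntertwining' := fun g => by
        apply LinearMap.ext
        intro v
        change Z *ᵥ ((T g).val *ᵥ v) = (T g).val *ᵥ (Z *ᵥ v)
        rw [Matrix.mulVec_mulVec, Matrix.mulVec_mulVec, hZ] }
  obtain ⟨c, hc⟩ :=
    (Representation.IsIrreducible.algebraMap_intertwiningMap_bijective_of_isAlgClosed).2 f
  refine ⟨c, ?_⟩
  apply Matrix.toLin'.injective
  apply LinearMap.ext
  intro v
  have h1 : f v = (algebraMap ℂ _ c : Representation.IntertwiningMap (unitaryRep T)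
      (unitaryRep T)) v := by rw [hc]
  rw [Matrix.toLin'_apply, Matrix.toLin'_apply, Matrix.smul_mulVec, Matrix.one_mulVec]
  exact h1

/-- Orthogonal families of intertwiners bound the multiplicity from below. -/
theorem card_le_multiplicity {κ : Type*} [Fintype κ] (W : Subrepresentation (unitaryRep T))
    (P Z : κ → Matrix N N ℂ) (hP : ∀ i j, i ≠ j → P i * P j = 0) (hPZ : ∀ i, P i * Z i = Z i)
    (hZ : ∀ i g, (T g).val * Z i = Z i * (T g).val)
    (hne : ∀ i, ∃ v ∈ W.toSubmodule, Z i *ᵥ v ≠ 0) :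
    Fintype.card κ ≤ multiplicity W.toRepresentation (unitaryRep T) := by
  let toLin : Representation.IntertwiningMap W.toRepresentation (unitaryRep T) →ₗ[ℂ]
      (W.toSubmodule →ₗ[ℂ] (N → ℂ)) :=
    { toFun := fun f => f.toLinearMap
      map_add' := fun _ _ => rfl
      map_smul' := fun _ _ => rfl }
  have hinj : Function.Injective toLin := fun f g h => Representation.IntertwiningMap.ext h
  have : Module.Finite ℂ (Representation.IntertwiningMap W.toRepresentation (unitaryRep T)) :=
    Module.Finite.of_injective toLin hinj
  have hli : LinearIndependent ℂ fun i => intertwiningOfCommute (Z i) (hZ i) W := by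
    rw [Fintype.linearIndependent_iff]
    intro c hc i
    obtain ⟨v, hv, hv0⟩ := hne i
    -- Applying `P i` to a linear relation annihilates every term except the i-th, because the
    -- ranges lie in mutually orthogonal blocks.
    have h1 := congrArg (fun f => P i *ᵥ (toLin f ⟨v, hv⟩)) hc
    simp only [map_sum, map_smul, map_zero, LinearMap.sum_apply, LinearMap.smul_apply,
      LinearMap.zero_apply, Matrix.mulVec_zero] at h1
    have h2 : ∀ j, toLin (intertwiningOfCommute (Z j) (hZ j) W) ⟨v, hv⟩ = Z j *ᵥ v :=
      fun j => rfl
    simp only [h2, Matrix.mulVec_sum, Matrix.mulVec_smul, Matrix.mulVec_mulVec] at h1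
    rw [Finset.sum_eq_single i] at h1
    · rw [hPZ] at h1
      exact (smul_eq_zero.mp h1).resolve_right hv0
    · intro j _ hj
      rw [← hPZ j, ← Matrix.mul_assoc, hP i j hj.symm, Matrix.zero_mul, Matrix.zero_mulVec,
        smul_zero]
    · simp
  exact hli.fintype_card_le_finrank

end Projectors

/-! ### Averages over the group and orthogonality relations -/

section Average

variable {G : Type*} [Group G] [TopologicalSpace G] [IsTopologicalGroup G]
    [CompactSpace G] [MeasurableSpace G] [BorelSpace G]
    {μ : Measure G} [μ.IsHaarMeasure] [IsProbabilityMeasure μ]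
    {N : Type*} [Fintype N] [DecidableEq N] {T : G →* Matrix.unitaryGroup N ℂ}

theorem integrable_of_continuous {E : Type*} [NormedAddCommGroup E] {f : G → E}
    (hf : Continuous f) : Integrable f μ :=
  hf.integrable_of_hasCompactSupport (HasCompactSupport.of_compactSpace f)

/-- The average of `T_g Y T_g†`. -/
def twirl (μ : Measure G) (T : G →* Matrix.unitaryGroup N ℂ) (Y : Matrix N N ℂ) :
    Matrix N N ℂ :=
  Matrix.of fun i j => ∫ g, ((T g).val * Y * (T g).valᴴ) i j ∂μ

theorem continuous_val (hT : Continuous T) : Continuous fun g => (T g).val :=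
  continuous_subtype_val.comp hT

/-- A linear functional is a finite combination of entries, so it passes under the entrywise
integral; no norm on matrices has to be chosen. -/
theorem map_twirl (hT : Continuous T) (L : Matrix N N ℂ →ₗ[ℂ] ℂ) (Y : Matrix N N ℂ) :
    L (twirl μ T Y) = ∫ g, L ((T g).val * Y * (T g).valᴴ) ∂μ := by
  have hL : ∀ M, L M = ∑ i, ∑ j, M i j * L (Matrix.single i j 1) := by
    intro M
    conv_lhs => rw [matrix_eq_sum_single M]
    simp only [map_sum]
    refine Finset.sum_congr rfl fun i _ => Finset.sum_congr rfl fun j _ => ?_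
    rw [← smul_eq_mul, ← map_smul, smul_single, smul_eq_mul, mul_one]
  have hc := continuous_val hT
  have hcont : ∀ i j, Continuous fun g => ((T g).val * Y * (T g).valᴴ) i j := fun i j =>
    ((hc.matrix_mul continuous_const).matrix_mul hc.matrix_conjTranspose).matrix_elem i j
  simp_rw [fun g => hL ((T g).val * Y * (T g).valᴴ)]
  rw [hL, integral_finsetSum]
  · refine Finset.sum_congr rfl fun i _ => ?_
    rw [integral_finsetSum]
    · refine Finset.sum_congr rfl fun j _ => ?_
      rw [integral_mul_const]
      rfl
    · intro j _
      exact integrable_of_continuous ((hcont i j).mul continuous_const)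
  · intro i _
    exact integrable_of_continuous
      (continuous_finsetSum _ fun j _ => (hcont i j).mul continuous_const)

/-- The entries of `A M B`, linearly in `M`. -/
def entryOfMul (A B : Matrix N N ℂ) (i j : N) : Matrix N N ℂ →ₗ[ℂ] ℂ where
  toFun M := (A * M * B) i j
  map_add' X Y := by rw [Matrix.mul_add, Matrix.add_mul, Matrix.add_apply]
  map_smul' c X := by simp

theorem mul_twirl_mul_apply (hT : Continuous T) (A B Y : Matrix N N ℂ) (i j : N) :
    (A * twirl μ T Y * B) i j = ∫ g, (A * ((T g).val * Y * (T g).valᴴ) * B) i j ∂μ :=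
  map_twirl hT (entryOfMul A B i j) Y

theorem trace_twirl (hT : Continuous T) (Y : Matrix N N ℂ) :
    (twirl μ T Y).trace = Y.trace := by
  have h := map_twirl (μ := μ) hT (Matrix.traceLinearMap N ℂ ℂ) Y
  simp only [Matrix.traceLinearMap_apply] at h
  rw [h]
  have : ∀ g, ((T g).val * Y * (T g).valᴴ).trace = Y.trace := fun g => by
    rw [Matrix.trace_mul_comm, ← Matrix.mul_assoc, unitary_conjTranspose_mul, Matrix.one_mul]
  simp [this]

theorem conjTranspose_twirl (Y : Matrix N N ℂ) :
    (twirl μ T Y)ᴴ = twirl μ T Yᴴ := by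
  ext i j
  simp only [twirl, conjTranspose_apply, Matrix.of_apply]
  rw [Complex.star_def, ← integral_conj]
  refine integral_congr_ae (Filter.Eventually.of_forall fun g => ?_)
  have : ((T g).val * Yᴴ * (T g).valᴴ) = ((T g).val * Y * (T g).valᴴ)ᴴ := by
    simp [conjTranspose_mul, Matrix.mul_assoc]
  simp only [this]
  rfl

theorem mul_twirl_mul (hT : Continuous T) {A B : Matrix N N ℂ} (Y : Matrix N N ℂ)
    (hA : ∀ g, (T g).val * A = A * (T g).val) (hB : ∀ g, (T g).valᴴ * B = B * (T g).valᴴ) :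
    A * twirl μ T Y * B = twirl μ T (A * Y * B) := by
  ext i j
  rw [mul_twirl_mul_apply hT]
  simp only [twirl, Matrix.of_apply]
  refine integral_congr_ae (Filter.Eventually.of_forall fun g => ?_)
  have : A * ((T g).val * Y * (T g).valᴴ) * B = (T g).val * (A * Y * B) * (T g).valᴴ := by
    simp only [Matrix.mul_assoc, hB]
    simp only [← Matrix.mul_assoc, hA]
  simp only [this]

/-- Conjugation by T_h only replaces g by hg under the integral, and Haar measure is left invariant.
-/
theorem twirl_commute (hT : Continuous T) (Y : Matrix N N ℂ) (h : G) :
    (T h).val * twirl μ T Y = twirl μ T Y * (T h).val := by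
  have key : (T h).val * twirl μ T Y * (T h).valᴴ = twirl μ T Y := by
    ext i j
    rw [mul_twirl_mul_apply hT]
    simp only [twirl, Matrix.of_apply]
    rw [← integral_mul_left_eq_self (μ := μ) (fun g => ((T g).val * Y * (T g).valᴴ) i j) h]
    refine integral_congr_ae (Filter.Eventually.of_forall fun g => ?_)
    simp only [map_mul, Submonoid.coe_mul, conjTranspose_mul, Matrix.mul_assoc]
  calc (T h).val * twirl μ T Y
      = (T h).val * twirl μ T Y * ((T h).valᴴ * (T h).val) := by
        rw [unitary_conjTranspose_mul, Matrix.mul_one]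
    _ = twirl μ T Y * (T h).val := by rw [← Matrix.mul_assoc, key]

/-- Schur's lemma makes the twirl a multiple of `P`; twirling preserves the trace, which fixes the
scalar. -/
theorem twirl_of_irreducible (hT : Continuous T) {W : Subrepresentation (unitaryRep T)}
    (hW : W.toRepresentation.IsIrreducible) {P : Matrix N N ℂ}
    (hP : IsProjectorOnto W.toSubmodule P) (hd : P.trace ≠ 0) (Y : Matrix N N ℂ) :
    twirl μ T (P * Y * P) = ((P * Y).trace / P.trace) • P := by
  have hc : ∀ g, (T g).val * P = P * (T g).val := hP.commute
  have hm := mul_twirl_mul (μ := μ) hT Y hc (commute_conjTranspose hc)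
  obtain ⟨c, h⟩ := schur_on_subspace hW hP (twirl_commute (μ := μ) hT (P * Y * P))
    (by rw [← hm, ← Matrix.mul_assoc, ← Matrix.mul_assoc, hP.mul_self])
    (by rw [← hm, Matrix.mul_assoc, hP.mul_self])
  have ht := congrArg Matrix.trace h
  rw [trace_twirl hT, Matrix.trace_smul, smul_eq_mul, Matrix.trace_mul_comm, ← Matrix.mul_assoc,
    hP.mul_self] at ht
  rw [h, ht, mul_div_cancel_right₀ _ hd]

theorem twirl_of_irreducible_rep (hT : Continuous T) (hirr : (unitaryRep T).IsIrreducible)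
    (hd : (Fintype.card N : ℂ) ≠ 0) (Y : Matrix N N ℂ) :
    twirl μ T Y = (Y.trace / Fintype.card N) • (1 : Matrix N N ℂ) := by
  obtain ⟨c, h⟩ := schur_unitaryRep hirr (twirl_commute (μ := μ) hT Y)
  have ht := congrArg Matrix.trace h
  rw [trace_twirl hT, Matrix.trace_smul, smul_eq_mul, Matrix.trace_one] at ht
  rw [h, ht, mul_div_cancel_right₀ _ hd]

/-- The overlap of two matrix coefficients in terms of twirled matrices. -/
theorem integral_trace_mul_conj_trace (hT : Continuous T) {P Q : Matrix N N ℂ}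
    (hP : ∀ g, (T g).val * P = P * (T g).val) (hQ : ∀ g, (T g).val * Q = Q * (T g).val)
    (hQ' : Qᴴ = Q) (X : Matrix N N ℂ) :
    ∫ g, (Xᴴ * P * (T g).val).trace * star (Xᴴ * Q * (T g).val).trace ∂μ =
      ∑ q, ∑ s, (Xᴴ * twirl μ T (P * Matrix.single q s 1 * Q) * X) q s := by
  have hpt : ∀ g, (Xᴴ * P * (T g).val).trace * star (Xᴴ * Q * (T g).val).trace =
      ∑ q, ∑ s, (Xᴴ * ((T g).val * (P * Matrix.single q s 1 * Q) * (T g).valᴴ) * X :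
        Matrix N N ℂ) q s := by
    intro g
    have h1 : ∀ q s, Xᴴ * ((T g).val * (P * Matrix.single q s 1 * Q) * (T g).valᴴ) * X =
        (Xᴴ * P * (T g).val) * Matrix.single q s 1 * (Xᴴ * Q * (T g).val)ᴴ := by
      intro q s
      simp only [conjTranspose_mul, conjTranspose_conjTranspose, hQ', Matrix.mul_assoc]
      rw [← Matrix.mul_assoc (T g).val P, hP, ← Matrix.mul_assoc Q (T g).valᴴ,
        ← commute_conjTranspose hQ]
      simp only [Matrix.mul_assoc]
    -- Summed over q and s this is Tr A · conj(Tr B), so a product of two traces becomes linear in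
    -- twirled matrix units.
    have h2 : ∀ (A B : Matrix N N ℂ) (q s : N),
        (A * Matrix.single q s 1 * Bᴴ : Matrix N N ℂ) q s = A q q * star (B s s) := by
      intro A B q s
      rw [Matrix.mul_apply, Finset.sum_eq_single s]
      · simp
      · intro b _ hb
        rw [Matrix.mul_single_apply_of_ne _ _ _ _ _ hb, zero_mul]
      · simp
    simp only [h1, h2]
    rw [Matrix.trace, Matrix.trace, star_sum, Finset.sum_mul_sum]
    rfl
  have hc := continuous_val hT
  have hcont : ∀ Y : Matrix N N ℂ, ∀ i j,
      Continuous fun g => (Xᴴ * ((T g).val * Y * (T g).valᴴ) * X) i j := fun Y i j =>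
    ((continuous_const.matrix_mul ((hc.matrix_mul continuous_const).matrix_mul
      hc.matrix_conjTranspose)).matrix_mul continuous_const).matrix_elem i j
  simp_rw [hpt]
  rw [integral_finsetSum]
  · refine Finset.sum_congr rfl fun q _ => ?_
    rw [integral_finsetSum]
    · refine Finset.sum_congr rfl fun s _ => ?_
      rw [mul_twirl_mul_apply hT]
    · intro s _
      exact integrable_of_continuous (hcont _ q s)
  · intro q _
    exact integrable_of_continuous (continuous_finsetSum _ fun s _ => hcont _ q s)

/-- The squared norm of a matrix coefficient for a projector with scalar twirl. -/
theorem integral_trace_mul_conj_trace_self (hT : Continuous T) {P : Matrix N N ℂ}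
    (hP : ∀ g, (T g).val * P = P * (T g).val) (hP' : Pᴴ = P) {d : ℂ}
    (h : ∀ Y, twirl μ T (P * Y * P) = ((P * Y).trace / d) • P) (X : Matrix N N ℂ) :
    ∫ g, (Xᴴ * P * (T g).val).trace * star (Xᴴ * P * (T g).val).trace ∂μ =
      (Xᴴ * P * X * P).trace / d := by
  rw [integral_trace_mul_conj_trace hT hP hP hP', Matrix.trace, Finset.sum_div]
  refine Finset.sum_congr rfl fun q _ => ?_
  rw [Matrix.diag_apply, Matrix.mul_apply, Finset.sum_div]
  refine Finset.sum_congr rfl fun s _ => ?_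
  rw [h, Matrix.trace_mul_single]
  simp
  ring

/-- Square-integral of a matrix coefficient of an irreducible representation. -/
theorem integral_normSq_trace_of_irreducible (hT : Continuous T)
    (hirr : (unitaryRep T).IsIrreducible) (hd : (Fintype.card N : ℂ) ≠ 0) (X : Matrix N N ℂ) :
    ∫ g, Complex.normSq (Xᴴ * (T g).val).trace ∂μ = (Xᴴ * X).trace.re / Fintype.card N := by
  have h := integral_trace_mul_conj_trace_self (μ := μ) hT (P := 1) (by simp) (by simp)
    (d := Fintype.card N) (fun Y => by simpa using twirl_of_irreducible_rep hT hirr hd Y) X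
  simp only [Matrix.mul_one, Complex.star_def, Complex.mul_conj] at h
  rw [integral_complex_ofReal] at h
  have := congrArg Complex.re h
  rwa [Complex.ofReal_re, ← Complex.ofReal_natCast, Complex.div_ofReal_re] at this

theorem trace_conjTranspose_mul_self_nonneg {a b : Type*} [Fintype a] [Fintype b]
    (A : Matrix a b ℂ) : 0 ≤ (Aᴴ * A).trace.re := by
  rw [Matrix.trace, Complex.re_sum]
  refine Finset.sum_nonneg fun i _ => ?_
  rw [Matrix.diag_apply, Matrix.mul_apply, Complex.re_sum]
  refine Finset.sum_nonneg fun j _ => ?_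
  rw [conjTranspose_apply, Complex.star_def, mul_comm, Complex.mul_conj, Complex.ofReal_re]
  exact Complex.normSq_nonneg _

/-- Matrix coefficients of a unitary representation are bounded in mean square by the largest
ratio of multiplicity and dimension. -/
theorem integral_normSq_trace_le (hT : Continuous T) {r : ℝ}
    (hr : ∀ W : Subrepresentation (unitaryRep T), W.toRepresentation.IsIrreducible →
      multRatio W ≤ r) (X : Matrix N N ℂ) :
    ∫ g, Complex.normSq (Xᴴ * (T g).val).trace ∂μ ≤ r * (Xᴴ * X).trace.re := by
  classical
  obtain ⟨ι, _, W, P, hirr, hP, hort, hsum⟩ := exists_irreducible_decomposition T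
  have hcomm : ∀ i g, (T g).val * P i = P i * (T g).val := fun i => (hP i).commute
  set f : ι → G → ℂ := fun i g => (Xᴴ * P i * (T g).val).trace with hf
  have hfc : ∀ i, Continuous (f i) := fun i =>
    (continuous_const.matrix_mul (continuous_val hT)).matrix_trace
  have hfsum : ∀ g, (Xᴴ * (T g).val).trace = ∑ i, f i g := by
    intro g
    simp only [hf]
    rw [← Matrix.trace_sum, ← Matrix.sum_mul, ← Matrix.mul_sum, hsum, Matrix.mul_one]
  have hd : ∀ i, 0 < Module.finrank ℂ (W i).toSubmodule := fun i =>
    finrank_pos_of_isIrreducible (hirr i)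
  let a : ι → ℝ := fun i => ∫ g, Complex.normSq (f i g) ∂μ
  have ha : ∀ i, a i = (Xᴴ * P i * X * P i).trace.re / Module.finrank ℂ (W i).toSubmodule := by
    intro i
    have hd' : (P i).trace ≠ 0 := by
      rw [(hP i).trace_eq]; exact_mod_cast (hd i).ne'
    have h := integral_trace_mul_conj_trace_self (μ := μ) hT (hcomm i) (hP i).conjTranspose_eq
      (twirl_of_irreducible hT (hirr i) (hP i) hd') X
    simp only [Complex.star_def, Complex.mul_conj] at h
    rw [integral_complex_ofReal, (hP i).trace_eq] at h
    have := congrArg Complex.re h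
    rwa [Complex.ofReal_re, ← Complex.ofReal_natCast, Complex.div_ofReal_re] at this
  have hb : ∀ i j, 0 ≤ (Xᴴ * P i * X * P j).trace.re := by
    intro i j
    have : (Xᴴ * P i * X * P j).trace = ((P i * X * P j)ᴴ * (P i * X * P j)).trace := by
      simp only [conjTranspose_mul, (hP i).conjTranspose_eq, (hP j).conjTranspose_eq]
      rw [show P j * (Xᴴ * P i) * (P i * X * P j) = P j * (Xᴴ * (P i * P i) * X * P j) by
        simp only [Matrix.mul_assoc], (hP i).mul_self, Matrix.trace_mul_comm (P j)]
      simp only [Matrix.mul_assoc, (hP j).mul_self]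
    rw [this]
    exact trace_conjTranspose_mul_self_nonneg _
  -- These are the diagonal terms of the double block expansion of Tr(X† X); the discarded terms are
  -- nonnegative by `hb`.
  have hbsum : ∑ i, (Xᴴ * P i * X * P i).trace.re ≤ (Xᴴ * X).trace.re := by
    have h : (Xᴴ * X).trace.re = ∑ i, ∑ j, (Xᴴ * P i * X * P j).trace.re := by
      simp only [← Complex.re_sum, ← Matrix.trace_sum, ← Matrix.mul_sum, ← Matrix.sum_mul, hsum,
        Matrix.mul_one]
    rw [h]
    exact Finset.sum_le_sum fun i _ =>
      Finset.single_le_sum (f := fun j => (Xᴴ * P i * X * P j).trace.re)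
        (fun j _ => hb i j) (Finset.mem_univ i)
  -- A nonzero such twirl is an intertwiner from block j to block i, so `R` stands in for
  -- equivalence of blocks. Only its symmetry is needed.
  let R : ι → ι → Prop := fun i j => ∃ Y, twirl μ T (P i * Y * P j) ≠ 0
  have hRsymm : ∀ i j, R i j → R j i := by
    rintro i j ⟨Y, hY⟩
    refine ⟨Yᴴ, fun h => hY ?_⟩
    have h2 := congrArg conjTranspose h
    rw [conjTranspose_twirl] at h2
    simpa [conjTranspose_mul, (hP i).conjTranspose_eq, (hP j).conjTranspose_eq,
      Matrix.mul_assoc] using h2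
  -- The blocks j related to i receive nonzero intertwiners from `W i` with mutually orthogonal
  -- ranges, so the multiplicity bounds their number.
  have hcard : ∀ i, (Fintype.card {j // R j i} : ℝ) ≤
      multiplicity (W i).toRepresentation (unitaryRep T) := by
    intro i
    choose Y hY using fun j : {j // R j i} => j.2
    have hm := fun j : {j // R j i} => mul_twirl_mul (μ := μ) hT (Y j) (hcomm j.1)
      (commute_conjTranspose (hcomm i))
    exact_mod_cast card_le_multiplicity (W i) (fun j : {j // R j i} => P j.1)
      (fun j => twirl μ T (P j.1 * Y j * P i))
      (fun j k hjk => hort _ _ fun h => hjk (Subtype.ext h))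
      (fun j => by rw [← hm, ← Matrix.mul_assoc, ← Matrix.mul_assoc, (hP j.1).mul_self])
      (fun j => twirl_commute hT _) (fun j => by
        by_contra! hcon
        apply hY j
        have hz : twirl μ T (P j.1 * Y j * P i) * P i = twirl μ T (P j.1 * Y j * P i) := by
          rw [← hm, Matrix.mul_assoc, (hP i).mul_self]
        rw [← hz]
        apply Matrix.toLin'.injective
        apply LinearMap.ext
        intro v
        rw [Matrix.toLin'_apply, ← Matrix.mulVec_mulVec]
        simpa using hcon _ ((hP i).mem v))
  let c : ι → ι → ℝ := fun i j => ∫ g, (f i g * star (f j g)).re ∂μ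
  have hci : ∀ i j, Integrable (fun g => (f i g * star (f j g)).re) μ := fun i j =>
    integrable_of_continuous (Complex.continuous_re.comp ((hfc i).mul (hfc j).star))
  have hfi : ∀ i, Integrable (fun g => Complex.normSq (f i g)) μ := fun i =>
    integrable_of_continuous (Complex.continuous_normSq.comp (hfc i))
  have hc1 : ∀ i j, ¬ R i j → c i j = 0 := by
    intro i j hR
    have h := integral_trace_mul_conj_trace (μ := μ) hT (hcomm i) (hcomm j)
      (hP j).conjTranspose_eq X
    have hR' : ∀ Y, twirl μ T (P i * Y * P j) = 0 := fun Y => by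
      by_contra h; exact hR ⟨Y, h⟩
    simp only [hR', Matrix.mul_zero, Matrix.zero_mul, Matrix.zero_apply,
      Finset.sum_const_zero] at h
    have h2 := integral_re (μ := μ) (f := fun g => f i g * star (f j g))
      (integrable_of_continuous ((hfc i).mul (hfc j).star))
    calc c i j = (∫ g, f i g * star (f j g) ∂μ).re := h2
      _ = 0 := by rw [h]; rfl
  -- The inequality Re(z w̄) ≤ (|z|² + |w|²)/2, summed over related pairs, plays the role of
  -- Cauchy–Schwarz inside an isotypic component.
  have hc2 : ∀ i j, c i j ≤ (a i + a j) / 2 := by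
    intro i j
    have : (a i + a j) / 2 = ∫ g, (Complex.normSq (f i g) + Complex.normSq (f j g)) / 2 ∂μ := by
      rw [integral_div, integral_add (hfi i) (hfi j)]
    rw [this]
    refine integral_mono (hci i j) (((hfi i).add (hfi j)).div_const 2) fun g => ?_
    simp only [Complex.star_def, Complex.mul_re, Complex.conj_re, Complex.conj_im,
      Complex.normSq_apply]
    nlinarith [sq_nonneg ((f i g).re - (f j g).re), sq_nonneg ((f i g).im - (f j g).im)]
  have hexp : ∫ g, Complex.normSq (Xᴴ * (T g).val).trace ∂μ = ∑ i, ∑ j, c i j := by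
    have hpt : ∀ g, Complex.normSq (Xᴴ * (T g).val).trace =
        ∑ i, ∑ j, (f i g * star (f j g)).re := by
      intro g
      rw [hfsum, ← Complex.ofReal_re (Complex.normSq _), ← Complex.mul_conj, map_sum,
        Finset.sum_mul_sum, Complex.re_sum]
      simp only [Complex.re_sum]
      rfl
    simp_rw [hpt]
    rw [integral_finsetSum _ fun i _ => integrable_finsetSum _ fun j _ => hci i j]
    exact Finset.sum_congr rfl fun i _ => integral_finsetSum _ fun j _ => hci i j
  rw [hexp]
  have hle : ∀ i j, c i j ≤ (if R i j then a i / 2 else 0) + (if R i j then a j / 2 else 0) := by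
    intro i j
    by_cases hR : R i j
    · simp only [hR, if_true]; linarith [hc2 i j]
    · simp only [hR, if_false]; linarith [hc1 i j hR]
  have hcnt : ∀ i, ∑ j, (if R j i then a i / 2 else 0) =
      (Fintype.card {j // R j i} : ℝ) * (a i / 2) := by
    intro i
    rw [← Finset.sum_filter, Finset.sum_const, Fintype.card_subtype, nsmul_eq_mul]
  calc ∑ i, ∑ j, c i j
      ≤ ∑ i, ∑ j, ((if R i j then a i / 2 else 0) + (if R i j then a j / 2 else 0)) :=
        Finset.sum_le_sum fun i _ => Finset.sum_le_sum fun j _ => hle i j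
    _ = ∑ i, (Fintype.card {j // R j i} : ℝ) * a i := by
        simp only [Finset.sum_add_distrib]
        -- By symmetry of `R` the two halves are equal, and `a i` is counted once for each block
        -- related to i.
        rw [Finset.sum_comm (f := fun i j => if R i j then a j / 2 else 0)]
        have : ∀ i, ∑ j, (if R i j then a i / 2 else 0) = ∑ j, (if R j i then a i / 2 else 0) :=
          fun i => Finset.sum_congr rfl fun j _ =>
            if_congr ⟨hRsymm i j, hRsymm j i⟩ rfl rfl
        simp only [this, hcnt]
        rw [← Finset.sum_add_distrib]
        exact Finset.sum_congr rfl fun i _ => by ring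
    _ ≤ ∑ i, r * (Xᴴ * P i * X * P i).trace.re := by
        refine Finset.sum_le_sum fun i _ => ?_
        have hd' : (0 : ℝ) < Module.finrank ℂ (W i).toSubmodule := by exact_mod_cast hd i
        have h1 := hr (W i) (hirr i)
        rw [multRatio] at h1
        have h2 : (Fintype.card {j // R j i} : ℝ) / Module.finrank ℂ (W i).toSubmodule ≤ r :=
          (div_le_div_of_nonneg_right (hcard i) hd'.le).trans h1
        rw [ha, ← mul_div_assoc, mul_div_right_comm]
        exact mul_le_mul_of_nonneg_right h2 (hb i i)
    _ ≤ r * (Xᴴ * X).trace.re := by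
        rw [← Finset.mul_sum]
        -- Any irreducible block forces 0 ≤ r; without blocks 1 = 0 and both sides vanish.
        by_cases hι : Nonempty ι
        · obtain ⟨i⟩ := hι
          have : 0 ≤ r := le_trans (by unfold multRatio; positivity) (hr (W i) (hirr i))
          exact mul_le_mul_of_nonneg_left hbsum this
        · rw [not_nonempty_iff] at hι
          have : (1 : Matrix N N ℂ) = 0 := by rw [← hsum]; simp
          have hX : X = 0 := by rw [← Matrix.mul_one X, this, Matrix.mul_zero]
          simp [hX]

end Average

/-! ### Kraus representations -/

section Kraus

variable {a b c d : Type*} [Fintype a] [DecidableEq a] [Fintype b] [DecidableEq b]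
  [Fintype c] [DecidableEq c] [Fintype d] [DecidableEq d]

/-- The map `X ↦ ∑ i, K i X (K i)†`. -/
def krausMap {ι : Type*} [Fintype ι] (K : ι → Matrix b a ℂ) :
    Matrix a a ℂ →ₗ[ℂ] Matrix b b ℂ where
  toFun X := ∑ i, K i * X * (K i)ᴴ
  map_add' X Y := by simp only [Matrix.mul_add, Matrix.add_mul, Finset.sum_add_distrib]
  map_smul' t X := by
    simp only [Matrix.mul_smul, Matrix.smul_mul, Finset.smul_sum, RingHom.id_apply]

theorem krausMap_apply {ι : Type*} [Fintype ι] (K : ι → Matrix b a ℂ) (X : Matrix a a ℂ) :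
    krausMap K X = ∑ i, K i * X * (K i)ᴴ := rfl

theorem id_eq_krausMap :
    (LinearMap.id : Matrix a a ℂ →ₗ[ℂ] Matrix a a ℂ) = krausMap fun _ : Unit => 1 := by
  ext1 X
  simp [krausMap_apply]

theorem unitaryChannel_eq_krausMap (W : Matrix.unitaryGroup a ℂ) :
    unitaryChannel W = krausMap fun _ : Unit => W.val := by
  apply LinearMap.ext
  intro X
  simp [krausMap_apply, unitaryChannel]

/-- Matrix units of the product are Kronecker products of matrix units, so product arguments
determine the map. -/
theorem tensorMap_eq_of_kronecker (Φ : Matrix a a ℂ →ₗ[ℂ] Matrix b b ℂ)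
    (Ψ : Matrix c c ℂ →ₗ[ℂ] Matrix d d ℂ)
    (F : Matrix (a × c) (a × c) ℂ →ₗ[ℂ] Matrix (b × d) (b × d) ℂ)
    (h : ∀ X Y, F (X ⊗ₖ Y) = Φ X ⊗ₖ Ψ Y) : tensorMap Φ Ψ = F := by
  apply LinearMap.ext
  intro X
  rw [map_eq_sum_single (tensorMap Φ Ψ) X, map_eq_sum_single F X]
  refine Finset.sum_congr rfl fun i _ => Finset.sum_congr rfl fun j _ => ?_
  have : (Matrix.single i j 1 : Matrix (a × c) (a × c) ℂ) =
      Matrix.single i.1 j.1 1 ⊗ₖ Matrix.single i.2 j.2 1 := by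
    simp [Matrix.single_kronecker_single]
  rw [this, tensorMap_kronecker, h]

theorem tensorMap_krausMap {ι κ : Type*} [Fintype ι] [Fintype κ] (K : ι → Matrix b a ℂ)
    (L : κ → Matrix d c ℂ) :
    tensorMap (krausMap K) (krausMap L) = krausMap fun x : ι × κ => K x.1 ⊗ₖ L x.2 := by
  apply tensorMap_eq_of_kronecker
  intro X Y
  simp only [krausMap_apply, Fintype.sum_prod_type, conjTranspose_kronecker,
    ← mul_kronecker_mul]
  ext ⟨p, q⟩ ⟨p', q'⟩
  simp only [Matrix.sum_apply, kroneckerMap_apply, Finset.sum_mul_sum]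

theorem isCompletelyPositive_krausMap {ι : Type*} [Fintype ι] (K : ι → Matrix b a ℂ) :
    IsCompletelyPositive (krausMap K) := by
  intro k X hX
  rw [id_eq_krausMap, tensorMap_krausMap, krausMap_apply]
  exact Matrix.posSemidef_sum _ fun i _ => hX.mul_mul_conjTranspose_same _

/-- Every completely positive map has a Kraus representation. -/
theorem IsCompletelyPositive.exists_krausMap {Φ : Matrix a a ℂ →ₗ[ℂ] Matrix b b ℂ}
    (h : IsCompletelyPositive Φ) :
    ∃ (N : ℕ) (K : Fin N → Matrix b a ℂ), Φ = krausMap K := by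
  let e := Fintype.equivFin a
  -- The unnormalized maximally entangled vector; its image under Φ ⊗ id is the Choi matrix. Writing
  -- that positive matrix as a sum of terms v v† and reshaping each v gives the Kraus operators.
  let φ : a × Fin (Fintype.card a) → ℂ := fun x => if e x.1 = x.2 then 1 else 0
  have h1 := h _ _ (Matrix.posSemidef_vecMulVec_self_star φ)
  obtain ⟨N, v, hv⟩ := Matrix.posSemidef_iff_eq_sum_vecMulVec.mp h1
  have hC : ∀ p q i j, (tensorMap Φ (LinearMap.id : Matrix (Fin (Fintype.card a)) _ ℂ →ₗ[ℂ] _)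
      (vecMulVec φ (star φ))) (p, e i) (q, e j) = Φ (Matrix.single i j 1) p q := by
    intro p q i j
    simp only [tensorMap, LinearMap.coe_mk, AddHom.coe_mk, Matrix.sum_apply, Matrix.smul_apply,
      kroneckerMap_apply, LinearMap.id_apply, vecMulVec_apply, φ, Matrix.single_apply,
      Pi.star_apply, smul_eq_mul, apply_ite star, star_one, star_zero, mul_ite, ite_mul, one_mul,
      mul_one, zero_mul, mul_zero, ite_and]
    simp
  refine ⟨N, fun x => Matrix.of fun p i => v x (p, e i), ?_⟩
  apply LinearMap.ext
  intro X
  rw [map_eq_sum_single Φ, map_eq_sum_single (krausMap _)]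
  refine Finset.sum_congr rfl fun i _ => Finset.sum_congr rfl fun j _ => ?_
  congr 1
  ext p q
  rw [← hC, hv, krausMap_apply, Matrix.sum_apply, Matrix.sum_apply]
  refine Finset.sum_congr rfl fun x _ => ?_
  rw [Matrix.mul_apply, Finset.sum_eq_single j]
  · simp [vecMulVec_apply]
  · intro k _ hk
    rw [Matrix.mul_single_apply_of_ne _ _ _ _ _ hk, zero_mul]
  · simp

theorem isChannel_krausMap {ι : Type*} [Fintype ι] {K : ι → Matrix b a ℂ}
    (h : ∑ i, (K i)ᴴ * K i = 1) : IsChannel (krausMap K) where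
  completelyPositive := isCompletelyPositive_krausMap K
  trace_eq X := by
    rw [krausMap_apply, Matrix.trace_sum]
    simp only [Matrix.trace_mul_comm _ (K _)ᴴ, ← Matrix.mul_assoc]
    rw [← Matrix.trace_sum, ← Matrix.sum_mul, h, Matrix.one_mul]

theorem IsChannel.isQuantumOperation {Φ : Matrix a a ℂ →ₗ[ℂ] Matrix b b ℂ} (h : IsChannel Φ) :
    IsQuantumOperation Φ where
  completelyPositive := h.completelyPositive
  trace_le X _ := by rw [h.trace_eq]

theorem trace_tensorMap {Φ : Matrix a a ℂ →ₗ[ℂ] Matrix b b ℂ}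
    {Ψ : Matrix c c ℂ →ₗ[ℂ] Matrix d d ℂ} (hΦ : ∀ X, (Φ X).trace = X.trace)
    (hΨ : ∀ X, (Ψ X).trace = X.trace) (X : Matrix (a × c) (a × c) ℂ) :
    (tensorMap Φ Ψ X).trace = X.trace := by
  simp only [tensorMap, LinearMap.coe_mk, AddHom.coe_mk, Matrix.trace_sum, Matrix.trace_smul,
    Matrix.trace_kronecker, hΦ, hΨ]
  simp only [Matrix.trace, Matrix.diag_apply, Matrix.single_apply, Fintype.sum_prod_type,
    smul_eq_mul, ite_and, Finset.sum_ite_eq, Finset.mem_univ, if_true, mul_ite, mul_one, mul_zero]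
  simp

/-- Each Kraus operator maps a pure state to an unnormalized pure state, so only squared amplitudes
remain to be averaged. -/
theorem overlap_krausMap_pureState {ι : Type*} [Fintype ι] (K : ι → Matrix b a ℂ) (ψ : b → ℂ)
    (φ : a → ℂ) :
    overlap ψ (krausMap K (pureState φ)) = ∑ i, Complex.normSq (star ψ ⬝ᵥ (K i *ᵥ φ)) := by
  rw [overlap, krausMap_apply, Matrix.sum_mulVec, dotProduct_sum, Complex.re_sum]
  refine Finset.sum_congr rfl fun i _ => ?_
  have h : K i * pureState φ * (K i)ᴴ = vecMulVec (K i *ᵥ φ) (star (K i *ᵥ φ)) := by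
    rw [pureState, Matrix.mul_vecMulVec, Matrix.vecMulVec_mul, Matrix.star_mulVec]
  rw [h, Matrix.vecMulVec_mulVec, dotProduct_smul]
  have h2 : star (K i *ᵥ φ) ⬝ᵥ ψ = star (star ψ ⬝ᵥ (K i *ᵥ φ)) :=
    Matrix.star_dotProduct _ _
  rw [h2]
  change ((star ψ ⬝ᵥ (K i *ᵥ φ)) * star (star ψ ⬝ᵥ (K i *ᵥ φ))).re = _
  rw [Complex.star_def, Complex.mul_conj, Complex.ofReal_re]

theorem trace_krausMap_pureState {ι : Type*} [Fintype ι] (K : ι → Matrix b a ℂ) (φ : a → ℂ) :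
    (krausMap K (pureState φ)).trace.re = ∑ i, ∑ p, Complex.normSq ((K i *ᵥ φ) p) := by
  rw [krausMap_apply, Matrix.trace_sum, Complex.re_sum]
  refine Finset.sum_congr rfl fun i _ => ?_
  have h : K i * pureState φ * (K i)ᴴ = vecMulVec (K i *ᵥ φ) (star (K i *ᵥ φ)) := by
    rw [pureState, Matrix.mul_vecMulVec, Matrix.vecMulVec_mul, Matrix.star_mulVec]
  rw [h, Matrix.trace, Complex.re_sum]
  refine Finset.sum_congr rfl fun p _ => ?_
  rw [Matrix.diag_apply, vecMulVec_apply, Pi.star_apply, Complex.star_def, Complex.mul_conj,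
    Complex.ofReal_re]

end Kraus

/-! ### Partial traces -/

section PartialTrace

variable {m n : Type*} [Fintype m] [DecidableEq m] [Fintype n] [DecidableEq n]

/-- The partial trace over the first factor. -/
def traceLeft (M : Matrix (m × n) (m × n) ℂ) : Matrix n n ℂ :=
  Matrix.of fun r s => ∑ p, M (p, r) (p, s)

theorem trace_traceLeft (M : Matrix (m × n) (m × n) ℂ) : (traceLeft M).trace = M.trace := by
  simp only [Matrix.trace, Matrix.diag_apply, traceLeft, Matrix.of_apply, Fintype.sum_prod_type]
  exact Finset.sum_comm

theorem traceLeft_mul_one_kronecker (M : Matrix (m × n) (m × n) ℂ) (B : Matrix n n ℂ) :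
    traceLeft (M * ((1 : Matrix m m ℂ) ⊗ₖ B)) = traceLeft M * B := by
  ext r s
  simp only [traceLeft, Matrix.of_apply, Matrix.mul_apply, Fintype.sum_prod_type,
    kroneckerMap_apply, Matrix.one_apply, ite_mul, one_mul, zero_mul, mul_ite, mul_zero,
    Finset.sum_mul]
  rw [Finset.sum_comm (γ := n)]
  refine Finset.sum_congr rfl fun p _ => ?_
  rw [Finset.sum_comm]
  simp

theorem traceLeft_one_kronecker_mul (M : Matrix (m × n) (m × n) ℂ) (B : Matrix n n ℂ) :
    traceLeft (((1 : Matrix m m ℂ) ⊗ₖ B) * M) = B * traceLeft M := by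
  ext r s
  simp only [traceLeft, Matrix.of_apply, Matrix.mul_apply, Fintype.sum_prod_type,
    kroneckerMap_apply, Matrix.one_apply, ite_mul, one_mul, zero_mul, Finset.mul_sum]
  rw [Finset.sum_comm (γ := n)]
  refine Finset.sum_congr rfl fun p _ => ?_
  rw [Finset.sum_comm]
  simp

theorem traceLeft_kronecker_one_comm (M : Matrix (m × n) (m × n) ℂ) (A : Matrix m m ℂ) :
    traceLeft ((A ⊗ₖ (1 : Matrix n n ℂ)) * M) = traceLeft (M * (A ⊗ₖ (1 : Matrix n n ℂ))) := by
  ext r s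
  simp only [traceLeft, Matrix.of_apply, Matrix.mul_apply, Fintype.sum_prod_type,
    kroneckerMap_apply, Matrix.one_apply, mul_ite, mul_one, mul_zero, ite_mul, zero_mul,
    Finset.sum_ite_eq, Finset.sum_ite_eq', Finset.mem_univ, if_true]
  rw [Finset.sum_comm]
  exact Finset.sum_congr rfl fun p _ => Finset.sum_congr rfl fun q _ => mul_comm _ _

/-- Write 1 ⊗ B = (A† ⊗ 1)(A ⊗ B). The factor A ⊗ B moves past `P` by hypothesis, and A† ⊗ 1 is
cyclic under the partial trace over its own factor, where it cancels A. -/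
theorem traceLeft_commute {A : Matrix m m ℂ} {B : Matrix n n ℂ} {P : Matrix (m × n) (m × n) ℂ}
    (h1 : Aᴴ * A = 1) (h2 : A * Aᴴ = 1) (h : (A ⊗ₖ B) * P = P * (A ⊗ₖ B)) :
    B * traceLeft P = traceLeft P * B := by
  have e1 : ((1 : Matrix m m ℂ) ⊗ₖ B) = (Aᴴ ⊗ₖ (1 : Matrix n n ℂ)) * (A ⊗ₖ B) := by
    rw [← mul_kronecker_mul, h1, Matrix.one_mul]
  have e2 : (A ⊗ₖ B) * (Aᴴ ⊗ₖ (1 : Matrix n n ℂ)) = ((1 : Matrix m m ℂ) ⊗ₖ B) := by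
    rw [← mul_kronecker_mul, h2, Matrix.mul_one]
  rw [← traceLeft_one_kronecker_mul, e1, Matrix.mul_assoc, h, traceLeft_kronecker_one_comm,
    Matrix.mul_assoc, e2, traceLeft_mul_one_kronecker]

/-- The partial trace over the second factor. -/
def traceRight (M : Matrix (m × n) (m × n) ℂ) : Matrix m m ℂ :=
  Matrix.of fun p q => ∑ r, M (p, r) (q, r)

theorem trace_traceRight (M : Matrix (m × n) (m × n) ℂ) : (traceRight M).trace = M.trace := by
  simp only [Matrix.trace, Matrix.diag_apply, traceRight, Matrix.of_apply,
    Fintype.sum_prod_type]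

/-- Exchanging the tensor factors reduces this to `traceLeft_commute`. -/
theorem traceRight_commute {A : Matrix m m ℂ} {B : Matrix n n ℂ}
    {P : Matrix (m × n) (m × n) ℂ} (h1 : Bᴴ * B = 1) (h2 : B * Bᴴ = 1)
    (h : (A ⊗ₖ B) * P = P * (A ⊗ₖ B)) : A * traceRight P = traceRight P * A := by
  have hs : (A ⊗ₖ B).submatrix (Equiv.prodComm n m) (Equiv.prodComm n m) = B ⊗ₖ A := by
    ext ⟨i, j⟩ ⟨k, l⟩
    simp [kroneckerMap_apply, mul_comm]
  have h3 : (B ⊗ₖ A) * P.submatrix (Equiv.prodComm n m) (Equiv.prodComm n m) =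
      P.submatrix (Equiv.prodComm n m) (Equiv.prodComm n m) * (B ⊗ₖ A) := by
    rw [← hs, Matrix.submatrix_mul_equiv, Matrix.submatrix_mul_equiv, h]
  have h4 : traceRight P = traceLeft (P.submatrix (Equiv.prodComm n m) (Equiv.prodComm n m)) := by
    ext p q
    simp [traceRight, traceLeft]
  rw [h4]
  exact traceLeft_commute h1 h2 h3

end PartialTrace

/-! ### Vectorized matrices -/

section Vectorization

variable {m n : Type*} [Fintype m] [DecidableEq m] [Fintype n] [DecidableEq n]

/-- A square matrix as a vector. -/
def vectorize (M : Matrix n n ℂ) : n × n → ℂ := fun x => M x.1 x.2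

/-- The coefficient `d^{-1/2}` of the Bell state. -/
def bellCoeff (n : Type*) [Fintype n] : ℂ := ((Real.sqrt (Fintype.card n) : ℝ) : ℂ)⁻¹

theorem normSq_bellCoeff (n : Type*) [Fintype n] :
    Complex.normSq (bellCoeff n) = (Fintype.card n : ℝ)⁻¹ := by
  rw [bellCoeff, Complex.normSq_inv, Complex.normSq_ofReal, Real.mul_self_sqrt (by positivity)]

theorem kronecker_one_mulVec_bell (M : Matrix n n ℂ) :
    (M ⊗ₖ (1 : Matrix n n ℂ)) *ᵥ bell n = bellCoeff n • vectorize M := by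
  ext ⟨i, j⟩
  simp only [Matrix.mulVec, dotProduct, bell, Fintype.sum_prod_type, kroneckerMap_apply,
    Matrix.one_apply, Pi.smul_apply, vectorize, smul_eq_mul, bellCoeff, mul_ite, mul_one,
    mul_zero, ite_mul, zero_mul]
  simp [mul_comm]

theorem bellOf_eq (W : Matrix.unitaryGroup n ℂ) :
    bellOf W = bellCoeff n • vectorize W.val := kronecker_one_mulVec_bell W.val

theorem sum_normSq_eq_trace {a b : Type*} [Fintype a] [Fintype b] (A : Matrix a b ℂ) :
    ∑ i, ∑ j, Complex.normSq (A i j) = (Aᴴ * A).trace.re := by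
  rw [Matrix.trace, Complex.re_sum, Finset.sum_comm]
  refine Finset.sum_congr rfl fun j _ => ?_
  rw [Matrix.diag_apply, Matrix.mul_apply, Complex.re_sum]
  refine Finset.sum_congr rfl fun i _ => ?_
  rw [conjTranspose_apply, Complex.star_def, mul_comm, Complex.mul_conj, Complex.ofReal_re]

theorem trace_pureState_bellOf [Nonempty n] (W : Matrix.unitaryGroup n ℂ) :
    (pureState (bellOf W)).trace = 1 := by
  have h : (pureState (bellOf W)).trace = ((Complex.normSq (bellCoeff n) *
      ∑ i, ∑ j, Complex.normSq (W.val i j) : ℝ) : ℂ) := by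
    rw [Matrix.trace, Fintype.sum_prod_type]
    push_cast
    rw [Finset.mul_sum]
    refine Finset.sum_congr rfl fun i _ => ?_
    rw [Finset.mul_sum]
    refine Finset.sum_congr rfl fun j _ => ?_
    rw [Matrix.diag_apply, pureState, vecMulVec_apply, Pi.star_apply, Complex.star_def,
      Complex.mul_conj, bellOf_eq, Pi.smul_apply, smul_eq_mul, map_mul]
    push_cast
    rfl
  rw [h, sum_normSq_eq_trace, unitary_conjTranspose_mul, normSq_bellCoeff, Matrix.trace_one,
    Complex.natCast_re, inv_mul_cancel₀ (by simp), Complex.ofReal_one]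

theorem trace_pureState_bell [Nonempty n] : (pureState (bell n)).trace = 1 := by
  have h := trace_pureState_bellOf (1 : Matrix.unitaryGroup n ℂ)
  rwa [bellOf, Submonoid.coe_one, Matrix.one_kronecker_one, Matrix.one_mulVec] at h

/-- The rearrangement of the indices of `K` that turns `⟨V|K|U⟩` into a pairing with
`V ⊗ Ū`. -/
def reshuffle (K : Matrix (m × m) (n × n) ℂ) : Matrix (m × n) (m × n) ℂ :=
  Matrix.of fun x y => K (x.1, y.1) (x.2, y.2)

/-- The conjugate of ⟨V|K|U⟩ is linear in V and in Ū. This is where the representation V ⊗ Ū comes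
from. -/
theorem vectorize_dotProduct_mulVec (K : Matrix (m × m) (n × n) ℂ) (V : Matrix m m ℂ)
    (U : Matrix n n ℂ) :
    star (vectorize V) ⬝ᵥ (K *ᵥ vectorize U) =
      star ((reshuffle K)ᴴ * (V ⊗ₖ U.map (starRingEnd ℂ))).trace := by
  have h1 : star (vectorize V) ⬝ᵥ (K *ᵥ vectorize U) =
      ∑ p, ∑ q, ∑ r, ∑ s, star (V p q) * (K (p, q) (r, s) * U r s) := by
    simp only [dotProduct, Matrix.mulVec, Fintype.sum_prod_type, Finset.mul_sum, vectorize,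
      Pi.star_apply]
  have h2 : star ((reshuffle K)ᴴ * (V ⊗ₖ U.map (starRingEnd ℂ))).trace =
      ∑ q, ∑ s, ∑ p, ∑ r, star (V p q) * (K (p, q) (r, s) * U r s) := by
    simp only [Matrix.trace, Matrix.diag_apply, Matrix.mul_apply, Fintype.sum_prod_type,
      star_sum, conjTranspose_apply, kroneckerMap_apply, Matrix.map_apply, reshuffle,
      Matrix.of_apply, star_mul', star_star]
    refine Finset.sum_congr rfl fun q _ => Finset.sum_congr rfl fun s _ =>
      Finset.sum_congr rfl fun p _ => Finset.sum_congr rfl fun r _ => ?_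
    rw [← Complex.star_def, star_star]
    ring
  rw [h1, h2, Finset.sum_comm]
  refine Finset.sum_congr rfl fun q _ => ?_
  symm
  rw [Finset.sum_comm]
  refine Finset.sum_congr rfl fun p _ => ?_
  exact Finset.sum_comm

/-- Reshuffling only permutes entries, so it keeps the Hilbert–Schmidt norm, the quantity shared by
the fidelity bound and the success probability. -/
theorem trace_reshuffle (K : Matrix (m × m) (n × n) ℂ) :
    ((reshuffle K)ᴴ * reshuffle K).trace.re = ∑ x, ∑ y, Complex.normSq (K x y) := by
  rw [← sum_normSq_eq_trace]
  simp only [Fintype.sum_prod_type, reshuffle, Matrix.of_apply]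
  refine Finset.sum_congr rfl fun p _ => ?_
  rw [Finset.sum_comm]

/-- Each component of K|U⟩ is a matrix coefficient of U, ready for Schur orthogonality. -/
theorem mulVec_vectorize (K : Matrix (m × m) (n × n) ℂ) (U : Matrix n n ℂ) (x : m × m) :
    (K *ᵥ vectorize U) x =
      ((Matrix.of fun r s => star (K x (r, s)) : Matrix n n ℂ)ᴴ * U).trace := by
  simp only [Matrix.mulVec, dotProduct, Fintype.sum_prod_type, vectorize, Matrix.trace,
    Matrix.diag_apply, Matrix.mul_apply, conjTranspose_apply, Matrix.of_apply, star_star]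
  exact Finset.sum_comm

end Vectorization

/-! ### The representation `V ⊗ Ū` and the universal bound -/

section Bound

variable {G : Type*} [Group G]
    {n m : Type*} [Fintype n] [DecidableEq n] [Fintype m] [DecidableEq m]

/-- `g ↦ V_g ⊗ Ū_g` as a homomorphism to the unitary group. -/
def tensorConjHom (U : G →* Matrix.unitaryGroup n ℂ) (V : G →* Matrix.unitaryGroup m ℂ) :
    G →* Matrix.unitaryGroup (m × n) ℂ where
  toFun g := ⟨(V g).val ⊗ₖ (U g).val.map (starRingEnd ℂ), by
    rw [Matrix.mem_unitaryGroup_iff, Matrix.star_eq_conjTranspose, conjTranspose_kronecker,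
      ← mul_kronecker_mul, unitary_mul_conjTranspose,
      ← Matrix.conjTranspose_map (starRingEnd ℂ) fun _ => rfl, ← Matrix.map_mul,
      unitary_mul_conjTranspose]
    simp⟩
  map_one' := by
    apply Subtype.ext
    simp [Matrix.map_one]
  map_mul' g h := by
    apply Subtype.ext
    simp [Matrix.map_mul, Matrix.mul_kronecker_mul]

/-- The unnormalized fidelity of a Kraus family. -/
def krausFidelity {ι : Type*} [Fintype ι] (K : ι → Matrix (m × m) (n × n) ℂ)
    (V : Matrix m m ℂ) (U : Matrix n n ℂ) : ℝ :=
  ∑ i, Complex.normSq (star (vectorize V) ⬝ᵥ (K i *ᵥ vectorize U))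

/-- The unnormalized success probability of a Kraus family. -/
def krausSuccess {ι : Type*} [Fintype ι] (K : ι → Matrix (m × m) (n × n) ℂ)
    (U : Matrix n n ℂ) : ℝ :=
  ∑ i, ∑ x, Complex.normSq ((K i *ᵥ vectorize U) x)

variable [TopologicalSpace G] [IsTopologicalGroup G]
    [CompactSpace G] [MeasurableSpace G] [BorelSpace G]
    {μ : Measure G} [μ.IsHaarMeasure] [IsProbabilityMeasure μ]
    {U : G →* Matrix.unitaryGroup n ℂ} {V : G →* Matrix.unitaryGroup m ℂ}

theorem continuous_tensorConjHom (hU : Continuous U) (hV : Continuous V) :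
    Continuous (tensorConjHom U V) := by
  apply Continuous.subtype_mk
  refine continuous_matrix fun x y => ?_
  exact ((continuous_val hV).matrix_elem x.1 y.1).mul
    (Complex.continuous_conj.comp ((continuous_val hU).matrix_elem x.2 y.2))

theorem integral_krausFidelity_le (hU : Continuous U) (hV : Continuous V) {r : ℝ}
    (hr : ∀ W : Subrepresentation (tensorConjRep U V), W.toRepresentation.IsIrreducible →
      multRatio W ≤ r) {ι : Type*} [Fintype ι] (K : ι → Matrix (m × m) (n × n) ℂ) :
    ∫ g, krausFidelity K (V g).val (U g).val ∂μ ≤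
      r * ∑ i, ∑ x, ∑ y, Complex.normSq (K i x y) := by
  have hT := continuous_tensorConjHom hU hV
  simp only [krausFidelity, vectorize_dotProduct_mulVec, Complex.star_def, Complex.normSq_conj]
  rw [integral_finsetSum, Finset.mul_sum]
  · refine Finset.sum_le_sum fun i _ => ?_
    rw [← trace_reshuffle]
    exact integral_normSq_trace_le hT hr _
  · intro i _
    exact integrable_of_continuous (Complex.continuous_normSq.comp
      (continuous_const.matrix_mul (continuous_val hT)).matrix_trace)

/-- Irreducibility of U makes the average depend on `K` only through its Hilbert–Schmidt norm; this
is what allows probabilistic operations to be bounded relative to their success. -/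
theorem integral_krausSuccess (hU : Continuous U) (hirr : (unitaryRep U).IsIrreducible)
    [Nonempty n] {ι : Type*} [Fintype ι] (K : ι → Matrix (m × m) (n × n) ℂ) :
    ∫ g, krausSuccess K (U g).val ∂μ =
      (∑ i, ∑ x, ∑ y, Complex.normSq (K i x y)) / Fintype.card n := by
  simp only [krausSuccess, mulVec_vectorize]
  have hi : ∀ X : Matrix n n ℂ,
      Integrable (fun g => Complex.normSq (Xᴴ * (U g).val).trace) μ := fun X =>
    integrable_of_continuous (Complex.continuous_normSq.comp
      (continuous_const.matrix_mul (continuous_val hU)).matrix_trace)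
  rw [integral_finsetSum _ fun i _ => integrable_finsetSum _ fun x _ => hi _, Finset.sum_div]
  refine Finset.sum_congr rfl fun i _ => ?_
  rw [integral_finsetSum _ fun x _ => hi _, Finset.sum_div]
  refine Finset.sum_congr rfl fun x _ => ?_
  rw [integral_normSq_trace_of_irreducible hU hirr (by simp), ← sum_normSq_eq_trace,
    Fintype.sum_prod_type]
  simp only [Matrix.of_apply, Complex.star_def, Complex.normSq_conj]

/-- The universal bound on the average fidelity by the average success probability. -/
theorem integral_krausFidelity_le_success (hU : Continuous U) (hV : Continuous V)
    (hirr : (unitaryRep U).IsIrreducible) [Nonempty n] {r : ℝ}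
    (hr : ∀ W : Subrepresentation (tensorConjRep U V), W.toRepresentation.IsIrreducible →
      multRatio W ≤ r) {ι : Type*} [Fintype ι] (K : ι → Matrix (m × m) (n × n) ℂ) :
    ∫ g, krausFidelity K (V g).val (U g).val ∂μ ≤
      r * (Fintype.card n * ∫ g, krausSuccess K (U g).val ∂μ) := by
  rw [integral_krausSuccess hU hirr, mul_div_cancel₀ _ (by simp)]
  exact integral_krausFidelity_le hU hV hr K

end Bound

/-! ### Fidelities and success probabilities in terms of Kraus operators -/

section Formulas

variable {G : Type*} [Group G] [MeasurableSpace G] (μ : Measure G)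
    {n m : Type*} [Fintype n] [DecidableEq n] [Fintype m] [DecidableEq m]
    (U : G →* Matrix.unitaryGroup n ℂ) (V : G →* Matrix.unitaryGroup m ℂ)

theorem normSq_smul_dotProduct {a : Type*} [Fintype a] (s t : ℂ) (v w : a → ℂ) :
    Complex.normSq (star (s • v) ⬝ᵥ (t • w)) =
      Complex.normSq s * Complex.normSq t * Complex.normSq (star v ⬝ᵥ w) := by
  rw [star_smul, smul_dotProduct, dotProduct_smul]
  simp only [smul_eq_mul, map_mul, Complex.star_def, Complex.normSq_conj]
  ring

theorem bellFidelity_krausMap {ι : Type*} [Fintype ι] (K : ι → Matrix (m × m) (n × n) ℂ) :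
    bellFidelity μ U V (krausMap K) = (Fintype.card m : ℝ)⁻¹ * (Fintype.card n : ℝ)⁻¹ *
      ∫ g, krausFidelity K (V g).val (U g).val ∂μ := by
  rw [bellFidelity, ← integral_const_mul]
  refine integral_congr_ae (Filter.Eventually.of_forall fun g => ?_)
  simp only [overlap_krausMap_pureState, krausFidelity, bellOf_eq, Matrix.mulVec_smul,
    normSq_smul_dotProduct, normSq_bellCoeff, Finset.mul_sum]

theorem bellSuccess_krausMap {ι : Type*} [Fintype ι] (K : ι → Matrix (m × m) (n × n) ℂ) :
    bellSuccess μ U (krausMap K) = (Fintype.card n : ℝ)⁻¹ *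
      ∫ g, krausSuccess K (U g).val ∂μ := by
  rw [bellSuccess, ← integral_const_mul]
  refine integral_congr_ae (Filter.Eventually.of_forall fun g => ?_)
  simp only [trace_krausMap_pureState, krausSuccess, bellOf_eq, Matrix.mulVec_smul,
    Pi.smul_apply, smul_eq_mul, map_mul, normSq_bellCoeff, Finset.mul_sum]

theorem tensorMap_krausMap_id {a b c ι : Type*} [Fintype a] [DecidableEq a] [Fintype b]
    [DecidableEq b] [Fintype c] [DecidableEq c] [Fintype ι] (K : ι → Matrix b a ℂ) :
    tensorMap (krausMap K) (LinearMap.id : Matrix c c ℂ →ₗ[ℂ] Matrix c c ℂ) =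
      krausMap fun i => K i ⊗ₖ (1 : Matrix c c ℂ) := by
  apply tensorMap_eq_of_kronecker
  intro X Y
  simp only [krausMap_apply, conjTranspose_kronecker, ← mul_kronecker_mul, conjTranspose_one,
    Matrix.one_mul, Matrix.mul_one, LinearMap.id_apply]
  ext ⟨p, q⟩ ⟨p', q'⟩
  simp only [Matrix.sum_apply, kroneckerMap_apply, Finset.sum_mul]

theorem network_krausMap {k : ℕ} {ι κ : Type*} [Fintype ι] [Fintype κ]
    (A : ι → Matrix (n × Fin k) m ℂ) (B : κ → Matrix m (n × Fin k) ℂ)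
    (W : Matrix.unitaryGroup n ℂ) :
    network (krausMap A) (krausMap B) W = krausMap fun x : κ × ι =>
      B x.1 * (W.val ⊗ₖ (1 : Matrix (Fin k) (Fin k) ℂ)) * A x.2 := by
  rw [network, unitaryChannel_eq_krausMap, tensorMap_krausMap_id]
  apply LinearMap.ext
  intro X
  simp only [LinearMap.comp_apply, krausMap_apply, Fintype.sum_prod_type, Matrix.mul_sum,
    Matrix.sum_mul, conjTranspose_mul, Matrix.mul_assoc, Fintype.sum_unique]

/-- The linear dependence of a network's Kraus operators on the inserted gate. -/
def networkKraus {k : ℕ} (A : Matrix (n × Fin k) m ℂ) (B : Matrix m (n × Fin k) ℂ) :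
    Matrix (m × m) (n × n) ℂ :=
  Matrix.of fun x y => ∑ j, B x.1 (y.1, j) * A (y.2, j) x.2

/-- Contracting the memory index leaves an operator acting on |W⟩, so a network with memory of any
size falls under the same bound as a Bell state conversion. -/
theorem vectorize_network {k : ℕ} (A : Matrix (n × Fin k) m ℂ) (B : Matrix m (n × Fin k) ℂ)
    (W : Matrix n n ℂ) :
    vectorize (B * (W ⊗ₖ (1 : Matrix (Fin k) (Fin k) ℂ)) * A) =
      networkKraus A B *ᵥ vectorize W := by
  ext ⟨p, q⟩
  simp only [vectorize, Matrix.mul_apply, Fintype.sum_prod_type, kroneckerMap_apply,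
    Matrix.one_apply, networkKraus, Matrix.of_apply, Matrix.mulVec, dotProduct, mul_ite, mul_one,
    mul_zero, Finset.sum_mul, Finset.sum_ite_eq',
    Finset.mem_univ, if_true]
  refine Eq.trans (Finset.sum_congr rfl fun s _ => Finset.sum_comm) ?_
  rw [Finset.sum_comm]
  refine Finset.sum_congr rfl fun r _ => Finset.sum_congr rfl fun s _ =>
    Finset.sum_congr rfl fun j _ => ?_
  ring

theorem gateFidelity_network {k : ℕ} {ι κ : Type*} [Fintype ι] [Fintype κ]
    (A : ι → Matrix (n × Fin k) m ℂ) (B : κ → Matrix m (n × Fin k) ℂ) :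
    gateFidelity μ V (fun g => network (krausMap A) (krausMap B) (U g)) =
      (Fintype.card m : ℝ)⁻¹ * (Fintype.card m : ℝ)⁻¹ * ∫ g, krausFidelity
        (fun x : κ × ι => networkKraus (A x.2) (B x.1)) (V g).val (U g).val ∂μ := by
  rw [gateFidelity, ← integral_const_mul]
  refine integral_congr_ae (Filter.Eventually.of_forall fun g => ?_)
  simp only [network_krausMap, tensorMap_krausMap_id, overlap_krausMap_pureState,
    kronecker_one_mulVec_bell, vectorize_network, bellOf_eq, normSq_smul_dotProduct,
    normSq_bellCoeff, krausFidelity, Finset.mul_sum]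

theorem gateSuccess_network {k : ℕ} {ι κ : Type*} [Fintype ι] [Fintype κ]
    (A : ι → Matrix (n × Fin k) m ℂ) (B : κ → Matrix m (n × Fin k) ℂ) :
    gateSuccess μ (fun g => network (krausMap A) (krausMap B) (U g)) =
      (Fintype.card m : ℝ)⁻¹ * ∫ g, krausSuccess
        (fun x : κ × ι => networkKraus (A x.2) (B x.1)) (U g).val ∂μ := by
  rw [gateSuccess, ← integral_const_mul]
  refine integral_congr_ae (Filter.Eventually.of_forall fun g => ?_)
  simp only [network_krausMap, tensorMap_krausMap_id, trace_krausMap_pureState,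
    kronecker_one_mulVec_bell, vectorize_network, Pi.smul_apply, smul_eq_mul, map_mul,
    normSq_bellCoeff, krausSuccess, Finset.mul_sum]

theorem network_trace {k : ℕ} {A : Matrix m m ℂ →ₗ[ℂ] Matrix (n × Fin k) (n × Fin k) ℂ}
    {B : Matrix (n × Fin k) (n × Fin k) ℂ →ₗ[ℂ] Matrix m m ℂ} (hA : IsChannel A)
    (hB : IsChannel B) (W : Matrix.unitaryGroup n ℂ) (X : Matrix m m ℂ) :
    (network A B W X).trace = X.trace := by
  rw [network, LinearMap.comp_apply, LinearMap.comp_apply, hB.trace_eq,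
    trace_tensorMap _ fun _ => rfl, hA.trace_eq]
  intro Y
  change (W.val * Y * W.valᴴ).trace = Y.trace
  rw [Matrix.trace_mul_comm, ← Matrix.mul_assoc, unitary_conjTranspose_mul, Matrix.one_mul]

theorem gateSuccess_of_isChannel [IsProbabilityMeasure μ] [Nonempty m] {k : ℕ}
    {A : Matrix m m ℂ →ₗ[ℂ] Matrix (n × Fin k) (n × Fin k) ℂ}
    {B : Matrix (n × Fin k) (n × Fin k) ℂ →ₗ[ℂ] Matrix m m ℂ} (hA : IsChannel A)
    (hB : IsChannel B) : gateSuccess μ (fun g => network A B (U g)) = 1 := by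
  have h : ∀ g, (tensorMap (network A B (U g)) (LinearMap.id : Matrix m m ℂ →ₗ[ℂ] _)
      (pureState (bell m))).trace.re = 1 := fun g => by
    rw [trace_tensorMap (network_trace hA hB _) fun _ => rfl, trace_pureState_bell,
      Complex.one_re]
  simp [gateSuccess, h]

theorem bellSuccess_of_isChannel [IsProbabilityMeasure μ] [Nonempty n]
    {C : Matrix (n × n) (n × n) ℂ →ₗ[ℂ] Matrix (m × m) (m × m) ℂ} (hC : IsChannel C) :
    bellSuccess μ U C = 1 := by
  have h : ∀ g, (C (pureState (bellOf (U g)))).trace.re = 1 := fun g => by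
    rw [hC.trace_eq, trace_pureState_bellOf, Complex.one_re]
  simp [bellSuccess, h]

end Formulas

/-! ### Optimal channels from an invariant projector -/

section Achievability

variable {n m : Type*} [Fintype n] [DecidableEq n] [Fintype m] [DecidableEq m]

/-- Kraus operators `n → m` given by the columns of a matrix on `m × n`. -/
def columnKraus (s : ℝ) (P : Matrix (m × n) (m × n) ℂ) (w : m × n) : Matrix m n ℂ :=
  Matrix.of fun p r => (s : ℂ) * P (p, r) w

/-- Kraus operators `n → m` given by the rows of a matrix on `m × n`. -/
def rowKraus (s : ℝ) (P : Matrix (m × n) (m × n) ℂ) (w : m × n) : Matrix m n ℂ :=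
  Matrix.of fun q r => (s : ℂ) * P w (q, r)

/-- The combined Kraus operators of a column family and a row family. -/
def projectorKraus (c : ℝ) (P : Matrix (m × n) (m × n) ℂ) (w : (m × n) × (m × n)) :
    Matrix (m × m) (n × n) ℂ :=
  Matrix.of fun x y => (c : ℂ) * (P (x.1, y.1) w.1 * P w.2 (x.2, y.2))

theorem entry_of_projector {P : Matrix (m × n) (m × n) ℂ} (h1 : P * P = P) (h2 : Pᴴ = P)
    (x y : m × n) : ∑ w, star (P x w) * P y w = P y x := by
  conv_rhs => rw [← h1, Matrix.mul_apply]
  refine Finset.sum_congr rfl fun w _ => ?_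
  have : star (P x w) = P w x := by
    conv_rhs => rw [← h2]
    rfl
  rw [this, mul_comm]

theorem entry_of_projector' {P : Matrix (m × n) (m × n) ℂ} (h1 : P * P = P) (h2 : Pᴴ = P)
    (x y : m × n) : ∑ w, star (P w x) * P w y = P x y := by
  conv_rhs => rw [← h1, Matrix.mul_apply]
  refine Finset.sum_congr rfl fun w _ => ?_
  have : star (P w x) = P x w := by
    conv_rhs => rw [← h2]
    rfl
  rw [this]

/-- Since P is an orthogonal projector, summing over columns gives back an entry of P; what remains
is s² times a partial trace, normalized by `hs`. -/
theorem sum_columnKraus {P : Matrix (m × n) (m × n) ℂ} (h1 : P * P = P) (h2 : Pᴴ = P) {s : ℝ}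
    {t : ℂ} (ht : traceLeft P = t • 1) (hs : (s : ℂ) ^ 2 * t = 1) :
    ∑ w, (columnKraus s P w)ᴴ * columnKraus s P w = 1 := by
  ext r r'
  -- The column family produces the transposed partial trace, hence the exchanged indices; for a
  -- scalar matrix this is harmless.
  have h := congrFun (congrFun ht r') r
  rw [Matrix.sum_apply]
  simp only [columnKraus, Matrix.mul_apply, conjTranspose_apply, Matrix.of_apply, star_mul',
    Complex.star_def, Complex.conj_ofReal]
  rw [Finset.sum_comm]
  have h3 : ∀ p, ∑ w, (s : ℂ) * (starRingEnd ℂ) (P (p, r) w) * (s * P (p, r') w) =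
      (s : ℂ) ^ 2 * P (p, r') (p, r) := fun p => by
    rw [← entry_of_projector h1 h2 (p, r) (p, r'), Finset.mul_sum]
    refine Finset.sum_congr rfl fun w _ => ?_
    rw [Complex.star_def]; ring
  simp only [h3]
  rw [← Finset.mul_sum]
  simp only [traceLeft, Matrix.of_apply] at h
  rw [h, Matrix.smul_apply, smul_eq_mul, ← mul_assoc, hs, one_mul, Matrix.one_apply,
    Matrix.one_apply]
  simp only [eq_comm]

theorem sum_rowKraus {P : Matrix (m × n) (m × n) ℂ} (h1 : P * P = P) (h2 : Pᴴ = P) {s : ℝ}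
    {t : ℂ} (ht : traceLeft P = t • 1) (hs : (s : ℂ) ^ 2 * t = 1) :
    ∑ w, (rowKraus s P w)ᴴ * rowKraus s P w = 1 := by
  ext r r'
  have h := congrFun (congrFun ht r) r'
  rw [Matrix.sum_apply]
  simp only [rowKraus, Matrix.mul_apply, conjTranspose_apply, Matrix.of_apply, star_mul',
    Complex.star_def, Complex.conj_ofReal]
  rw [Finset.sum_comm]
  have h3 : ∀ p, ∑ w, (s : ℂ) * (starRingEnd ℂ) (P w (p, r)) * (s * P w (p, r')) =
      (s : ℂ) ^ 2 * P (p, r) (p, r') := fun p => by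
    rw [← entry_of_projector' h1 h2 (p, r) (p, r'), Finset.mul_sum]
    refine Finset.sum_congr rfl fun w _ => ?_
    rw [Complex.star_def]; ring
  simp only [h3]
  rw [← Finset.mul_sum]
  simp only [traceLeft, Matrix.of_apply] at h
  rw [h, Matrix.smul_apply, smul_eq_mul, ← mul_assoc, hs, one_mul]

/-- In a network the row family acts before the gate, from `m` to `n`, so trace preservation
involves the partial trace over the other factor. -/
theorem sum_rowKraus_transpose {P : Matrix (m × n) (m × n) ℂ} (h1 : P * P = P) (h2 : Pᴴ = P)
    {s : ℝ} {t : ℂ} (ht : traceRight P = t • 1) (hs : (s : ℂ) ^ 2 * t = 1) :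
    ∑ w, (rowKraus s P w)ᵀᴴ * (rowKraus s P w)ᵀ = 1 := by
  ext q q'
  have h := congrFun (congrFun ht q) q'
  rw [Matrix.sum_apply]
  simp only [rowKraus, Matrix.mul_apply, conjTranspose_apply, Matrix.transpose_apply,
    Matrix.of_apply, star_mul', Complex.star_def, Complex.conj_ofReal]
  rw [Finset.sum_comm]
  have h3 : ∀ r, ∑ w, (s : ℂ) * (starRingEnd ℂ) (P w (q, r)) * (s * P w (q', r)) =
      (s : ℂ) ^ 2 * P (q, r) (q', r) := fun r => by
    rw [← entry_of_projector' h1 h2 (q, r) (q', r), Finset.mul_sum]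
    refine Finset.sum_congr rfl fun w _ => ?_
    rw [Complex.star_def]; ring
  simp only [h3]
  rw [← Finset.mul_sum]
  simp only [traceRight, Matrix.of_apply] at h
  rw [h, Matrix.smul_apply, smul_eq_mul, ← mul_assoc, hs, one_mul]

/-- With a column and a row of P as Kraus indices, the amplitudes are exactly the entries of P T† P.
-/
theorem star_trace_reshuffle_projectorKraus {P : Matrix (m × n) (m × n) ℂ} (c : ℝ)
    (T : Matrix (m × n) (m × n) ℂ) (w : (m × n) × (m × n)) :
    star ((reshuffle (projectorKraus c P w))ᴴ * T).trace = (c : ℂ) * (P * Tᴴ * P) w.2 w.1 := by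
  simp only [Matrix.trace, Matrix.diag_apply, Matrix.mul_apply, star_sum, conjTranspose_apply,
    reshuffle, Matrix.of_apply, star_mul', star_star, projectorKraus, Finset.sum_mul,
    Finset.mul_sum, Prod.mk.eta]
  rw [Finset.sum_comm]
  refine Finset.sum_congr rfl fun x _ => Finset.sum_congr rfl fun y _ => ?_
  ring

/-- The fidelity of the projector Kraus operators. -/
theorem krausFidelity_projectorKraus {P : Matrix (m × n) (m × n) ℂ} (h1 : P * P = P)
    (h2 : Pᴴ = P) (c : ℝ) {V : Matrix m m ℂ} {U : Matrix n n ℂ}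
    (hT : (V ⊗ₖ U.map (starRingEnd ℂ))ᴴ * (V ⊗ₖ U.map (starRingEnd ℂ)) = 1)
    (hP : (V ⊗ₖ U.map (starRingEnd ℂ)) * P = P * (V ⊗ₖ U.map (starRingEnd ℂ))) :
    krausFidelity (projectorKraus c P) V U = c ^ 2 * P.trace.re := by
  set T := V ⊗ₖ U.map (starRingEnd ℂ) with hTdef
  simp only [krausFidelity, vectorize_dotProduct_mulVec, ← hTdef,
    star_trace_reshuffle_projectorKraus, map_mul, Complex.normSq_ofReal]
  rw [← Finset.mul_sum, Fintype.sum_prod_type, Finset.sum_comm, ← pow_two]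
  -- The squared entries add up to the Hilbert–Schmidt norm of P T† P, which is Tr P because P
  -- commutes with the unitary T.
  refine (congrArg _ (sum_normSq_eq_trace (P * Tᴴ * P))).trans ?_
  congr 2
  have h3 : P * Tᴴ = Tᴴ * P := by
    have := congrArg conjTranspose hP
    rwa [conjTranspose_mul, conjTranspose_mul, h2] at this
  have h4 : T * Tᴴ = 1 := mul_eq_one_comm.mp hT
  rw [h3, Matrix.mul_assoc, h1, conjTranspose_mul, conjTranspose_conjTranspose, h2,
    Matrix.mul_assoc, ← Matrix.mul_assoc T, h4, Matrix.one_mul, h1]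

theorem columnKraus_kronecker_rowKraus (s : ℝ) (P : Matrix (m × n) (m × n) ℂ)
    (w : (m × n) × (m × n)) :
    columnKraus s P w.1 ⊗ₖ rowKraus s P w.2 = projectorKraus (s ^ 2) P w := by
  ext ⟨p, q⟩ ⟨r, r'⟩
  simp only [kroneckerMap_apply, columnKraus, rowKraus, projectorKraus, Matrix.of_apply]
  push_cast
  ring

/-- With a one-dimensional memory, transposing the row operator yields the same combined operators
as the tensor product in the Bell case, so one fidelity computation serves both. -/
theorem networkKraus_columnKraus_rowKraus (s t : ℝ) (P : Matrix (m × n) (m × n) ℂ)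
    (w : (m × n) × (m × n)) :
    networkKraus (k := 1) ((rowKraus t P w.2)ᵀ.submatrix Prod.fst id)
      ((columnKraus s P w.1).submatrix id Prod.fst) = projectorKraus (s * t) P w := by
  ext ⟨p, q⟩ ⟨r, r'⟩
  simp only [networkKraus, columnKraus, rowKraus, projectorKraus, Matrix.of_apply,
    Matrix.submatrix_apply, Matrix.transpose_apply, id, Finset.univ_unique, Finset.sum_singleton]
  push_cast
  ring

/-- A memoryless network is a network with a one-dimensional memory. -/
theorem network_one_eq_memorylessNetwork {ι κ : Type*} [Fintype ι] [Fintype κ]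
    (A : ι → Matrix n m ℂ) (B : κ → Matrix m n ℂ) (W : Matrix.unitaryGroup n ℂ) :
    network (k := 1) (krausMap fun i => (A i).submatrix Prod.fst id)
      (krausMap fun i => (B i).submatrix id Prod.fst) W =
      memorylessNetwork (krausMap A) (krausMap B) W := by
  have hk : ∀ i j, ((B j).submatrix id Prod.fst : Matrix m (n × Fin 1) ℂ) *
      (W.val ⊗ₖ (1 : Matrix (Fin 1) (Fin 1) ℂ)) *
      ((A i).submatrix Prod.fst id : Matrix (n × Fin 1) m ℂ) = B j * W.val * A i := by
    intro i j
    ext p q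
    simp only [Matrix.mul_apply, Fintype.sum_prod_type, kroneckerMap_apply,
      Matrix.submatrix_apply, id, Finset.univ_unique, Finset.sum_singleton, Matrix.one_apply_eq,
      mul_one]
  rw [network_krausMap, memorylessNetwork, unitaryChannel_eq_krausMap]
  simp only [hk]
  apply LinearMap.ext
  intro X
  simp only [LinearMap.comp_apply, krausMap_apply, Fintype.sum_prod_type, Matrix.mul_sum,
    Matrix.sum_mul, conjTranspose_mul, Matrix.mul_assoc, Fintype.sum_unique]

theorem isChannel_submatrix_left {ι : Type*} [Fintype ι] {A : ι → Matrix n m ℂ}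
    (h : ∑ i, (A i)ᴴ * A i = 1) :
    IsChannel (krausMap fun i => (A i).submatrix (Prod.fst : n × Fin 1 → n) id) := by
  apply isChannel_krausMap
  rw [← h]
  refine Finset.sum_congr rfl fun i _ => ?_
  ext p q
  simp [Matrix.mul_apply, Fintype.sum_prod_type]

theorem isChannel_submatrix_right {ι : Type*} [Fintype ι] {B : ι → Matrix m n ℂ}
    (h : ∑ i, (B i)ᴴ * B i = 1) :
    IsChannel (krausMap fun i => (B i).submatrix id (Prod.fst : n × Fin 1 → n)) := by
  apply isChannel_krausMap
  ext ⟨r, i⟩ ⟨s, j⟩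
  have := congrFun (congrFun h r) s
  rw [Matrix.sum_apply] at this ⊢
  simp only [Matrix.mul_apply, conjTranspose_apply, Matrix.submatrix_apply, id] at this ⊢
  rw [this, Subsingleton.elim i j]
  simp [Matrix.one_apply]

end Achievability

/-! ### Optimality criteria -/

section Optimality

variable {G : Type*} [Group G] [TopologicalSpace G] [IsTopologicalGroup G]
    [CompactSpace G] [MeasurableSpace G] [BorelSpace G]
    {μ : Measure G} [μ.IsHaarMeasure] [IsProbabilityMeasure μ]
    {n m : Type*} [Fintype n] [DecidableEq n] [Fintype m] [DecidableEq m]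
    {U : G →* Matrix.unitaryGroup n ℂ} {V : G →* Matrix.unitaryGroup m ℂ}

/-- The fidelity carries the normalization 1/(d_out d_in) and the success probability 1/d_in; the
universal bound contributes r·d_in. -/
theorem probBellFidelities_le (hU : Continuous U) (hV : Continuous V)
    (hirr : (unitaryRep U).IsIrreducible) [Nonempty n] [Nonempty m] {r : ℝ}
    (hr : ∀ W : Subrepresentation (tensorConjRep U V), W.toRepresentation.IsIrreducible →
      multRatio W ≤ r) {f : ℝ} (hf : f ∈ probBellFidelities μ U V) :
    f ≤ r * Fintype.card n / Fintype.card m := by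
  obtain ⟨M, hM, hpos, rfl⟩ := hf
  obtain ⟨N, K, rfl⟩ := hM.completelyPositive.exists_krausMap
  have hn : (0 : ℝ) < Fintype.card n := by exact_mod_cast Fintype.card_pos
  have hm : (0 : ℝ) < Fintype.card m := by exact_mod_cast Fintype.card_pos
  have h := integral_krausFidelity_le_success (μ := μ) hU hV hirr hr K
  rw [div_le_iff₀ hpos, bellFidelity_krausMap, bellSuccess_krausMap]
  calc _ ≤ (Fintype.card m : ℝ)⁻¹ * (Fintype.card n : ℝ)⁻¹ *
        (r * (Fintype.card n * ∫ g, krausSuccess K (U g).val ∂μ)) :=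
        mul_le_mul_of_nonneg_left h (by positivity)
    _ = _ := by ring

/-- Here the normalizations are 1/d_out² and 1/d_out, so the quotient has the same bound. -/
theorem probGateFidelities_le (hU : Continuous U) (hV : Continuous V)
    (hirr : (unitaryRep U).IsIrreducible) [Nonempty n] [Nonempty m] {r : ℝ}
    (hr : ∀ W : Subrepresentation (tensorConjRep U V), W.toRepresentation.IsIrreducible →
      multRatio W ≤ r) {f : ℝ} (hf : f ∈ probGateFidelities μ U V) :
    f ≤ r * Fintype.card n / Fintype.card m := by
  obtain ⟨k, A, B, hA, hB, hpos, rfl⟩ := hf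
  obtain ⟨a, A, rfl⟩ := hA.completelyPositive.exists_krausMap
  obtain ⟨b, B, rfl⟩ := hB.completelyPositive.exists_krausMap
  have hm : (0 : ℝ) < Fintype.card m := by exact_mod_cast Fintype.card_pos
  have h := integral_krausFidelity_le_success (μ := μ) hU hV hirr hr
    (fun x : Fin b × Fin a => networkKraus (A x.2) (B x.1))
  rw [div_le_iff₀ hpos, gateFidelity_network, gateSuccess_network]
  calc _ ≤ (Fintype.card m : ℝ)⁻¹ * (Fintype.card m : ℝ)⁻¹ * (r * (Fintype.card n *
        ∫ g, krausSuccess (fun x : Fin b × Fin a => networkKraus (A x.2) (B x.1))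
          (U g).val ∂μ)) :=
        mul_le_mul_of_nonneg_left h (by positivity)
    _ = _ := by ring

/-- A channel that attains an upper bound for probabilistic conversions is optimal. -/
theorem isOptimalBellConversion_of_bound [Nonempty n]
    {C : Matrix (n × n) (n × n) ℂ →ₗ[ℂ] Matrix (m × m) (m × m) ℂ} (hC : IsChannel C)
    (h : ∀ f ∈ probBellFidelities μ U V, f ≤ bellFidelity μ U V C) :
    IsOptimalBellConversion μ U V C := by
  have hsub : detBellFidelities μ U V ⊆ probBellFidelities μ U V := by
    rintro _ ⟨D, hD, rfl⟩
    refine ⟨D, hD.isQuantumOperation, ?_, ?_⟩ <;> simp [bellSuccess_of_isChannel μ U hD]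
  have hmem : bellFidelity μ U V C ∈ detBellFidelities μ U V := ⟨C, hC, rfl⟩
  exact ⟨⟨hmem, fun f hf => h f (hsub hf)⟩, ⟨hsub hmem, h⟩⟩

/-- A deterministic network that attains an upper bound for probabilistic networks is optimal. -/
theorem isOptimalGateSimulation_of_bound [Nonempty m]
    {Q : G → (Matrix m m ℂ →ₗ[ℂ] Matrix m m ℂ)}
    (hmem : gateFidelity μ V Q ∈ detGateFidelities μ U V)
    (h : ∀ f ∈ probGateFidelities μ U V, f ≤ gateFidelity μ V Q) :
    IsOptimalGateSimulation μ U V Q := by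
  have hsub : detGateFidelities μ U V ⊆ probGateFidelities μ U V := by
    rintro _ ⟨k, A, B, hA, hB, rfl⟩
    refine ⟨k, A, B, hA.isQuantumOperation, hB.isQuantumOperation, ?_, ?_⟩ <;>
      simp [gateSuccess_of_isChannel μ U hA hB]
  exact ⟨⟨hmem, fun f hf => h f (hsub hf)⟩, ⟨hsub hmem, h⟩⟩

/-- The partial trace commutes with Ū, so its entrywise conjugate commutes with the irreducible U
and is scalar by Schur's lemma. -/
theorem traceLeft_projector (hirr : (unitaryRep U).IsIrreducible) [Nonempty n]
    {P : Matrix (m × n) (m × n) ℂ}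
    (hP : ∀ g, (tensorConjHom U V g).val * P = P * (tensorConjHom U V g).val) :
    traceLeft P = (P.trace / Fintype.card n) • (1 : Matrix n n ℂ) := by
  have h1 : ∀ g, (U g).val.map (starRingEnd ℂ) * traceLeft P =
      traceLeft P * (U g).val.map (starRingEnd ℂ) := fun g =>
    traceLeft_commute (unitary_conjTranspose_mul (V g)) (unitary_mul_conjTranspose (V g)) (hP g)
  have hinv : ∀ M : Matrix n n ℂ, (M.map (starRingEnd ℂ)).map (starRingEnd ℂ) = M := fun M => by
    ext i j; simp
  obtain ⟨c, hc⟩ := schur_unitaryRep hirr (Z := (traceLeft P).map (starRingEnd ℂ)) fun g => by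
    have h2 := congrArg (fun M => M.map (starRingEnd ℂ)) (h1 g)
    simpa only [Matrix.map_mul, hinv] using h2
  have h3 : traceLeft P = (starRingEnd ℂ c) • (1 : Matrix n n ℂ) := by
    rw [← hinv (traceLeft P), hc]
    ext i j
    by_cases hij : i = j <;> simp [hij]
  have ht := congrArg Matrix.trace h3
  rw [trace_traceLeft, Matrix.trace_smul, smul_eq_mul, Matrix.trace_one] at ht
  rw [h3, ht, mul_div_cancel_right₀ _ (by simp)]

theorem traceRight_projector (hirr : (unitaryRep V).IsIrreducible) [Nonempty m]
    {P : Matrix (m × n) (m × n) ℂ}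
    (hP : ∀ g, (tensorConjHom U V g).val * P = P * (tensorConjHom U V g).val) :
    traceRight P = (P.trace / Fintype.card m) • (1 : Matrix m m ℂ) := by
  have hconj : ∀ g, ((U g).val.map (starRingEnd ℂ))ᴴ * (U g).val.map (starRingEnd ℂ) = 1 :=
    fun g => by
      rw [← Matrix.conjTranspose_map (starRingEnd ℂ) fun _ => rfl, ← Matrix.map_mul,
        unitary_conjTranspose_mul]
      simp
  obtain ⟨c, hc⟩ := schur_unitaryRep hirr (Z := traceRight P) fun g =>
    traceRight_commute (hconj g) (mul_eq_one_comm.mp (hconj g)) (hP g)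
  have ht := congrArg Matrix.trace hc
  rw [trace_traceRight, Matrix.trace_smul, smul_eq_mul, Matrix.trace_one] at ht
  rw [hc, ht, mul_div_cancel_right₀ _ (by simp)]

/-- The fidelity of the projector Kraus operators, averaged over the group. -/
theorem integral_krausFidelity_projectorKraus {P : Matrix (m × n) (m × n) ℂ} (h1 : P * P = P)
    (h2 : Pᴴ = P)
    (hP : ∀ g, (tensorConjHom U V g).val * P = P * (tensorConjHom U V g).val) (c : ℝ) :
    ∫ g, krausFidelity (projectorKraus c P) (V g).val (U g).val ∂μ = c ^ 2 * P.trace.re := by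
  have h : ∀ g, krausFidelity (projectorKraus c P) (V g).val (U g).val = c ^ 2 * P.trace.re :=
    fun g => krausFidelity_projectorKraus h1 h2 c
      (unitary_conjTranspose_mul (tensorConjHom U V g)) (hP g)
  simp [h]

end Optimality

end

end BellConversion

theorem theorem6 {G : Type*} [Group G] [TopologicalSpace G] [IsTopologicalGroup G]
    [CompactSpace G] [MeasurableSpace G] [BorelSpace G]
    (μ : Measure G) [μ.IsHaarMeasure] [IsProbabilityMeasure μ]
    {n m : Type*} [Fintype n] [DecidableEq n] [Fintype m] [DecidableEq m]
    (U : G →* Matrix.unitaryGroup n ℂ) (V : G →* Matrix.unitaryGroup m ℂ)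
    (hU : Continuous U) (hV : Continuous V)
    (hmax : ∃ W₀ : Subrepresentation (BellConversion.tensorConjRep U V),
      W₀.toRepresentation.IsIrreducible ∧
      BellConversion.multiplicity W₀.toRepresentation (BellConversion.tensorConjRep U V) = 1 ∧
      ∀ W : Subrepresentation (BellConversion.tensorConjRep U V),
        W.toRepresentation.IsIrreducible →
          BellConversion.multRatio W ≤ BellConversion.multRatio W₀) :
    ((BellConversion.unitaryRep U).IsIrreducible →
      ∃ A B : Matrix n n ℂ →ₗ[ℂ] Matrix m m ℂ,
        BellConversion.IsChannel A ∧ BellConversion.IsChannel B ∧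
        BellConversion.IsOptimalBellConversion μ U V (BellConversion.tensorMap A B)) ∧
    ((BellConversion.unitaryRep U).IsIrreducible → (BellConversion.unitaryRep V).IsIrreducible →
      ∃ (A : Matrix m m ℂ →ₗ[ℂ] Matrix n n ℂ) (B : Matrix n n ℂ →ₗ[ℂ] Matrix m m ℂ),
        BellConversion.IsChannel A ∧ BellConversion.IsChannel B ∧
        BellConversion.IsOptimalGateSimulation μ U V
          (fun g => BellConversion.memorylessNetwork A B (U g))) := by
  open BellConversion in
  obtain ⟨W₀, hirr₀, hmult, hle⟩ := hmax
  obtain ⟨P, hP⟩ := exists_isProjectorOnto W₀.toSubmodule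
  have hPT : ∀ g, (tensorConjHom U V g).val * P = P * (tensorConjHom U V g).val :=
    IsProjectorOnto.commute (T := tensorConjHom U V) (W := W₀) hP
  set d := Module.finrank ℂ W₀.toSubmodule with hd
  have hd0 : 0 < d := finrank_pos_of_isIrreducible hirr₀
  -- A nonzero irreducible subspace excludes empty index types, where the normalizations would
  -- degenerate.
  have hne : Nonempty (m × n) := by
    by_contra h0
    rw [not_nonempty_iff] at h0
    have : d = 0 := Module.finrank_zero_of_subsingleton
    omega
  have hn : Nonempty n := hne.map Prod.snd
  have hm : Nonempty m := hne.map Prod.fst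
  have hn0 : (0 : ℝ) < Fintype.card n := by exact_mod_cast Fintype.card_pos
  have hm0 : (0 : ℝ) < Fintype.card m := by exact_mod_cast Fintype.card_pos
  have hdr : (0 : ℝ) < d := by exact_mod_cast hd0
  have htr : P.trace = d := hP.trace_eq
  have htr' : P.trace.re = d := by rw [htr, Complex.natCast_re]
  -- Multiplicity one enters here: the upper bound becomes 1/d, the value that the projector
  -- construction reaches.
  have hr : multRatio W₀ = 1 / d := by rw [multRatio, hmult, Nat.cast_one]
  rw [hr] at hle
  -- The partial traces of P are (d/N)·1, with N = d_in or d_out, so the Kraus families need the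
  -- factor √(N/d).
  have hscale : ∀ N : ℕ, 0 < (N : ℝ) →
      ((Real.sqrt (N / d) : ℝ) : ℂ) ^ 2 * (P.trace / N) = 1 := by
    intro N hN
    rw [← Complex.ofReal_pow, Real.sq_sqrt (by positivity), htr]
    have h1 : (N : ℂ) ≠ 0 := by exact_mod_cast hN.ne'
    have h2 : (d : ℂ) ≠ 0 := by exact_mod_cast hd0.ne'
    push_cast
    field_simp
  have hcol : (unitaryRep U).IsIrreducible →
      ∑ w, (columnKraus (Real.sqrt (Fintype.card n / d)) P w)ᴴ *
        columnKraus (Real.sqrt (Fintype.card n / d)) P w = 1 := fun hUirr =>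
    sum_columnKraus hP.mul_self hP.conjTranspose_eq
      (traceLeft_projector hUirr hPT) (hscale _ hn0)
  constructor
  · intro hUirr
    have hrow := sum_rowKraus hP.mul_self hP.conjTranspose_eq
      (traceLeft_projector hUirr hPT) (hscale _ hn0)
    refine ⟨_, _, isChannel_krausMap (hcol hUirr), isChannel_krausMap hrow, ?_⟩
    have htensor : tensorMap (krausMap (columnKraus (Real.sqrt (Fintype.card n / d)) P))
        (krausMap (rowKraus (Real.sqrt (Fintype.card n / d)) P)) =
        krausMap (projectorKraus (Fintype.card n / d) P) := by
      rw [tensorMap_krausMap]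
      simp only [columnKraus_kronecker_rowKraus]
      rw [Real.sq_sqrt (by positivity)]
    apply isOptimalBellConversion_of_bound
    · refine ⟨?_, trace_tensorMap (isChannel_krausMap (hcol hUirr)).trace_eq
        (isChannel_krausMap hrow).trace_eq⟩
      rw [htensor]
      exact isCompletelyPositive_krausMap _
    · intro f hf
      refine (probBellFidelities_le hU hV hUirr hle hf).trans_eq ?_
      rw [htensor, bellFidelity_krausMap,
        integral_krausFidelity_projectorKraus hP.mul_self hP.conjTranspose_eq hPT, htr']
      -- Both sides equal d_in/(d · d_out), since (d_in/d)² · d/(d_out d_in) has that value.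
      field_simp
  · intro hUirr hVirr
    have hrow := sum_rowKraus_transpose hP.mul_self hP.conjTranspose_eq
      (traceRight_projector hVirr hPT) (hscale _ hm0)
    refine ⟨_, _, isChannel_krausMap hrow, isChannel_krausMap (hcol hUirr), ?_⟩
    have hnet : (fun g => memorylessNetwork
        (krausMap fun w => (rowKraus (Real.sqrt (Fintype.card m / d)) P w)ᵀ)
        (krausMap (columnKraus (Real.sqrt (Fintype.card n / d)) P)) (U g)) = fun g =>
        network (k := 1) (krausMap fun w =>
          (rowKraus (Real.sqrt (Fintype.card m / d)) P w)ᵀ.submatrix Prod.fst id)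
          (krausMap fun w =>
            (columnKraus (Real.sqrt (Fintype.card n / d)) P w).submatrix id Prod.fst) (U g) :=
      funext fun g => (network_one_eq_memorylessNetwork _ _ _).symm
    rw [hnet]
    apply isOptimalGateSimulation_of_bound
    · exact ⟨1, _, _, isChannel_submatrix_left hrow, isChannel_submatrix_right (hcol hUirr), rfl⟩
    · intro f hf
      refine (probGateFidelities_le hU hV hUirr hle hf).trans_eq ?_
      rw [gateFidelity_network]
      simp only [networkKraus_columnKraus_rowKraus]
      rw [integral_krausFidelity_projectorKraus hP.mul_self hP.conjTranspose_eq hPT, htr',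
        mul_pow, Real.sq_sqrt (by positivity), Real.sq_sqrt (by positivity)]
      -- The factors √(d_in/d) and √(d_out/d) give (d_in/d)(d_out/d) · d/d_out², again d_in/(d ·
      -- d_out).
      field_simp
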